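/- Let $K\ge 1$ and let $\mathbb T$ be the rooted metric tree in which the root has exactly one edge (denoted $0$) and every other vertex has $K+1$ edges. Each edge $e\in\mathcal E$ has a length $L_e\in(0,\infty)$ and a coordinate $l\in[0,L_e]$ increasing away from the root; $\mathcal N_e^+$ is the set of the $K$ edges forward to $e$. Let $-\Delta_{\mathbb T}\psi=-\psi''$ act on the functions $\psi\in L^2(\mathbb T)$ with $\psi_e\in H^2[0,L_e]$ and $\psi''\in L^2(\mathbb T)$ that are continuous at the vertices, satisfy the Kirchhoff conditions $\psi_e'(L_e)=\sum_{f\in\mathcal N_e^+}\psi_f'(0)$, and satisfy $\cos\alpha\,\psi_0(0)-\sin\alpha\,\psi_0'(0)=0$ at the root. Put $\mathbb C^+=\{\operatorname{Im}z>0\}$ and let $\sqrt z$ have positive imaginary part. **A.** Suppose that for some $\alpha\in[0,\pi)$ this operator is self-adjoint (equivalently, since its domain is maximal, symmetric). Then, for each $z\in\mathbb C^+$ and each point $u$ on an edge, other than its far end point, there is a square-integrable solution $\psi^+(\cdot;z|u)$ of $-\psi''=z\psi$ on the forward subtree $\mathbb T_u^+$ with the continuity and Kirchhoff conditions at its vertices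 (and no condition at $u$), normalized by $\psi^+(u;z|u)=1$. It is unique, it vanishes nowhere, and the Weyl–Titchmarsh (WT) function $R^+(x;z)=\partial_x\psi^+(x;z|u)/\psi^+(x;z|u)$ does not depend on $u$. Write $R_e^+(l;z)$ for its value at coordinate $l$ on the edge $e$. It has the following properties. (i) For each $x$, $R^+(x;\cdot)$ is analytic and maps $\mathbb C^+$ into $\mathbb C^+$. (ii) For each $e\in\mathcal E$ and $z\in\mathbb C^+$, $$|R_e^+(0;z)|\le\frac{2\sqrt{|z|}}{1-e^{-2L_e\operatorname{Im}\sqrt z}},\qquad |R_e^+(L_e;z)|\le\sum_{f\in\mathcal N_e^+}\frac{2\sqrt{|z|}}{1-e^{-2L_f\operatorname{Im}\sqrt z}},$$ and in particular $|R_e^+(L_e;z)|\le 2K\sqrt{|z|}\,\bigl[1-e^{-2(\min_{f\in\mathcal N_e^+}L_f)\operatorname{Im}\sqrt z}\bigr]^{-1}$. (iii) Along each edge $e$, for $z\in\mathbb C^+$ and $l\in[0,L_e]$, the Riccati equation $\partial_lR_e^+(l;z)+z+R_e^+(l;z)^2=0$ holds (with one-sided derivatives at the end points), and $$R_e^+(l;z)=\frac{R_e^+(0;z)\cos(\sqrt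 z\,l)-\sqrt z\,\sin(\sqrt z\,l)}{\cos(\sqrt z\,l)+R_e^+(0;z)\sin(\sqrt z\,l)/\sqrt z},$$ where the denominator is nonzero. **B.** Let $L_{\min}>0$. If $L_e\ge L_{\min}$ for all $e$, the hypothesis of A holds for every $\alpha\in[0,\pi)$. Moreover: (iv) For each $z\in\mathbb C^+$, $R_0^+(0;z)$ is a continuous function of $\{L_e\}_{e\in\mathcal E}\in[L_{\min},\infty)^{\mathcal E}$, where this space carries the uniform topology. -/

import Mathlib

open MeasureTheory Set

open scoped UniformConvergence

/-- The edges of the rooted tree with branching number `K`: the root edge is the empty word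
`[]` (it joins the root to the first branching vertex), and the `K` edges forward to an edge `e`
(all starting at the far end point of `e`) are the words `i :: e` with `i : Fin K`. -/
abbrev TreeEdge (K : ℕ) : Type := List (Fin K)

/-- A point of the metric tree, given by an edge and a coordinate along it. The coordinate
increases away from the root, from `0` to the length of the edge. -/
structure TreePoint (K : ℕ) where
  edge : TreeEdge K
  pos : ℝ

/-- The root of the tree. -/
def TreePoint.root (K : ℕ) : TreePoint K := ⟨[], 0⟩

/-- A function on the tree together with candidates for its first and second derivatives along
the edges. -/
structure TreeFun (K : ℕ) where
  val : TreeEdge K → ℝ → ℂ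
  der : TreeEdge K → ℝ → ℂ
  der2 : TreeEdge K → ℝ → ℂ

/-- `f` belongs to the Sobolev space `H²[a, b]`, with first derivative `f'` and with weak second
derivative `f''`: both `f` and `f'` are absolutely continuous, and `f''` is square integrable. -/
structure IsH2 (a b : ℝ) (f f' f'' : ℝ → ℂ) : Prop where
  val_eq : ∀ x ∈ Icc a b, f x = f a + ∫ t in a..x, f' t
  der_eq : ∀ x ∈ Icc a b, f' x = f' a + ∫ t in a..x, f'' t
  memLp : MemLp f'' 2 (volume.restrict (Icc a b))

/-- The coordinate at which the edge `f` starts in the forward subtree `𝕋⁺_u` cut off at `u`. -/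
noncomputable def TreePoint.start {K : ℕ} (u : TreePoint K) (f : TreeEdge K) : ℝ :=
  open Classical in if f = u.edge then u.pos else 0

/-- The point `(f, x)` lies in the forward subtree `𝕋⁺_u`. -/
def TreePoint.Below {K : ℕ} (L : TreeEdge K → ℝ) (u : TreePoint K) (f : TreeEdge K) (x : ℝ) :
    Prop :=
  u.edge <:+ f ∧ x ∈ Icc (u.start f) (L f)

/-- The maximal domain of the Laplacian on `𝕋⁺_u` with no condition imposed at `u` (so the domain
of the adjoint of the Laplacian with the conditions `ψ(u) = ψ'(u) = 0` at `u`): square-integrable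
functions which are `H²` along each edge and have a square-integrable second derivative, are
continuous at the vertices, and satisfy the Kirchhoff conditions there. -/
structure InMaxDomain {K : ℕ} (L : TreeEdge K → ℝ) (u : TreePoint K) (ψ : TreeFun K) : Prop where
  isH2 : ∀ f, u.edge <:+ f → IsH2 (u.start f) (L f) (ψ.val f) (ψ.der f) (ψ.der2 f)
  continuous : ∀ f, u.edge <:+ f → ∀ i : Fin K, ψ.val (i :: f) 0 = ψ.val f (L f)
  kirchhoff : ∀ f, u.edge <:+ f → ψ.der f (L f) = ∑ i : Fin K, ψ.der (i :: f) 0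
  summable_val : Summable fun f : {f : TreeEdge K // u.edge <:+ f} =>
    ∫ x in (u.start f.1)..(L f.1), ‖ψ.val f.1 x‖ ^ 2
  summable_der2 : Summable fun f : {f : TreeEdge K // u.edge <:+ f} =>
    ∫ x in (u.start f.1)..(L f.1), ‖ψ.der2 f.1 x‖ ^ 2

/-- The domain of the Laplacian `-Δ_𝕋` on the whole tree with the boundary condition
`cos α ψ(0) - sin α ψ'(0) = 0` at the root. -/
structure InLaplacianDomain {K : ℕ} (L : TreeEdge K → ℝ) (α : ℝ) (ψ : TreeFun K) : Prop where
  maxDomain : InMaxDomain L (TreePoint.root K) ψ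
  root_condition : (Real.cos α : ℂ) * ψ.val [] 0 - (Real.sin α : ℂ) * ψ.der [] 0 = 0

/-- The Laplacian `-Δ_𝕋 ψ = -ψ''` with `α`-boundary condition at the root is symmetric on its
domain: `⟨-Δ φ, ψ⟩ = ⟨φ, -Δ ψ⟩` in `L²(𝕋)`. This is implied by self-adjointness, and equivalent
to it, since the domain is maximal and therefore contains the domain of the adjoint operator. -/
def LaplacianIsSymmetric {K : ℕ} (L : TreeEdge K → ℝ) (α : ℝ) : Prop :=
  ∀ φ ψ : TreeFun K, InLaplacianDomain L α φ → InLaplacianDomain L α ψ →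
    ∑' e : TreeEdge K, ∫ x in (0 : ℝ)..(L e), (starRingEnd ℂ) (-φ.der2 e x) * ψ.val e x =
      ∑' e : TreeEdge K, ∫ x in (0 : ℝ)..(L e), (starRingEnd ℂ) (φ.val e x) * (-ψ.der2 e x)

/-- `ψ = ψ⁺(·; z | u)`: a square-integrable solution of `-ψ'' = z ψ` on the forward subtree `𝕋⁺_u`
satisfying the continuity and Kirchhoff conditions at the vertices, normalized by `ψ(u) = 1`. -/
structure IsWeylSolution {K : ℕ} (L : TreeEdge K → ℝ) (u : TreePoint K) (z : ℂ)
    (ψ : TreeFun K) : Prop where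
  maxDomain : InMaxDomain L u ψ
  equation : ∀ f, u.edge <:+ f →
    ∀ᵐ x ∂(volume.restrict (Icc (u.start f) (L f))), -ψ.der2 f x = z * ψ.val f x
  normalized : ψ.val u.edge u.pos = 1

/-- The Weyl-Titchmarsh function `R⁺_e(l; z) = ψ⁺'(x; z | 0) / ψ⁺(x; z | 0)` at the point `x` with
coordinate `l` on the edge `e`; the solution `ψ⁺(·; z | 0)` on the whole tree is used. (The value
is `0` if there is no such solution.) -/
noncomputable def wtFun {K : ℕ} (L : TreeEdge K → ℝ) (e : TreeEdge K) (l : ℝ) (z : ℂ) : ℂ :=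
  open Classical in
  if h : ∃ ψ : TreeFun K, IsWeylSolution L (TreePoint.root K) z ψ then
    h.choose.der e l / h.choose.val e l
  else 0

/-- The square root on the upper half-plane, with positive imaginary part there (principal
branch). -/
noncomputable def csqrt (z : ℂ) : ℂ := z ^ (1 / 2 : ℂ)

/-!
Write `s = √z`, with positive real and imaginary parts. The theorem is reduced to the study of
families `r` of complex numbers indexed by the edges (`IsWTFamily`): `r e` is a candidate for the
Weyl–Titchmarsh value at the near end of `e`, the Riccati flow carries it along `e` to the sum of
the values on the `K` edges forward to `e`, and `r e` lies in the closed convex cone `wtCone z` of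
the numbers `r` such that both `r` and `r / z` have nonnegative imaginary part.

*Existence.* By the energy identity `IsH2.energy` the backward flow preserves the cone, so starting
it from `i s` in generation `n` gives approximate families. Elements of the cone make at most a
right angle with `i s`; comparing outgoing and incoming waves, this gives the bound
`EdgeRel.norm_le` on the value at the near end of an edge, uniformly in `n`. Ultrafilter limits
(`exists_limit_wtFamily`) then produce families, whatever the edge lengths are. A family defines a
solution `wtSol` of `-ψ'' = z ψ` on the tree. Its mass on an edge is `1 / Im z` times the loss of
the flux `Im (conj ψ * ψ')` along the edge, and the flux is nonnegative, so the total mass is finite.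

*Uniqueness.* This is where the symmetry of the Laplacian enters. A square integrable solution on a
forward subtree, modified on a single edge by a cubic polynomial and extended by zero, lies in the
domain of the Laplacian. Symmetry then says that the flux into the subtree equals `Im z` times the
mass (`InMaxDomain.flux_eq`). A solution vanishing at the cut has no flux and hence no mass. In
particular there is exactly one family, and its values are those of `wtFun`.

*Consequences.* The bounds are those of `EdgeRel.norm_le`, and the Riccati equation and the Möbius
formula are read off from the explicit solutions on an edge. Since every ultrafilter limit of the approximations is the unique
family, they converge pointwise; being analytic and locally bounded in `z`, they have an analytic
limit. In the same way a limit of families for edge lengths bounded below is a family for the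
limiting edge lengths, which gives the continuity in the edge lengths.

*Symmetry for edge lengths bounded below.* The Wronskian of two functions of the domain, summed over
the ends of the edges of generation `n`, is by a Sobolev inequality bounded by the terms of
generation `n` of a convergent series, so it tends to zero.
-/

section WeylTitchmarsh

open Filter Topology

/-! ### Absolutely continuous functions and Sobolev functions on an interval -/

theorem IntervalIntegrable.absolutelyContinuousOnInterval_complex {f : ℝ → ℂ} {a b : ℝ}
    (hf : IntervalIntegrable f volume a b) :
    AbsolutelyContinuousOnInterval (fun x => ∫ t in a..x, f t) a b := by
  have hre : IntervalIntegrable (fun x => (f x).re) volume a b :=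
    ⟨hf.1.re, hf.2.re⟩
  have him : IntervalIntegrable (fun x => (f x).im) volume a b :=
    ⟨hf.1.im, hf.2.im⟩
  have hc : ∀ c : ℂ, AbsolutelyContinuousOnInterval (fun _ : ℝ => c) a b := fun c =>
    ContDiffOn.absolutelyContinuousOnInterval contDiffOn_const
  have h1 := ((hre.absolutelyContinuousOnInterval_intervalIntegral left_mem_uIcc).smul
    (hc 1)).add ((him.absolutelyContinuousOnInterval_intervalIntegral left_mem_uIcc).smul
    (hc Complex.I))
  -- the sum of the two real primitives agrees with the complex one on the interval
  refine (absolutelyContinuousOnInterval_iff _ _ _).2 ?_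
  intro ε hε
  obtain ⟨δ, hδ, H⟩ := (absolutelyContinuousOnInterval_iff _ _ _).1 h1 ε hε
  refine ⟨δ, hδ, fun E hE hlt => ?_⟩
  refine lt_of_eq_of_lt (Finset.sum_congr rfl fun i hi => ?_) (H E hE hlt)
  have key : ∀ x ∈ uIcc a b, ∫ t in a..x, f t =
      (∫ t in a..x, (f t).re) • (1 : ℂ) + (∫ t in a..x, (f t).im) • Complex.I := by
    intro x hx
    have hfx : IntervalIntegrable f volume a x :=
      hf.mono_set (uIcc_subset_uIcc left_mem_uIcc hx)
    have hrx : IntervalIntegrable (fun x => (f x).re) volume a x := ⟨hfx.1.re, hfx.2.re⟩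
    have hix : IntervalIntegrable (fun x => (f x).im) volume a x := ⟨hfx.1.im, hfx.2.im⟩
    rw [← intervalIntegral.integral_smul_const, ← intervalIntegral.integral_smul_const,
      ← intervalIntegral.integral_add]
    · refine intervalIntegral.integral_congr fun t _ => ?_
      simp
    · have : IntervalIntegrable (fun x => ((f x).re : ℂ)) volume a x :=
        ⟨hrx.1.ofReal, hrx.2.ofReal⟩
      simpa using this
    · have : IntervalIntegrable (fun x => ((f x).im : ℂ)) volume a x :=
        ⟨hix.1.ofReal, hix.2.ofReal⟩
      simpa using this.mul_const Complex.I
  have hm := hE.1 i hi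
  simp only [Pi.add_apply, Pi.smul_apply', key _ hm.1, key _ hm.2]

/-- The product rule for primitives of integrable functions. -/
theorem integral_deriv_mul_of_eq_primitive {u v u' v' : ℝ → ℂ} {a b : ℝ} (hab : a ≤ b)
    (hu' : IntervalIntegrable u' volume a b) (hv' : IntervalIntegrable v' volume a b)
    (hu : ∀ x ∈ Icc a b, u x = u a + ∫ t in a..x, u' t)
    (hv : ∀ x ∈ Icc a b, v x = v a + ∫ t in a..x, v' t) :
    ∫ x in a..b, (u' x * v x + u x * v' x) = u b * v b - u a * v a := by
  have hc : ∀ c : ℂ, AbsolutelyContinuousOnInterval (fun _ : ℝ => c) a b := fun c =>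
    ContDiffOn.absolutelyContinuousOnInterval contDiffOn_const
  set U : ℝ → ℂ := fun x => u a + ∫ t in a..x, u' t with hU
  set V : ℝ → ℂ := fun x => v a + ∫ t in a..x, v' t with hV
  have hUac : AbsolutelyContinuousOnInterval U a b :=
    (hc (u a)).add hu'.absolutelyContinuousOnInterval_complex
  have hVac : AbsolutelyContinuousOnInterval V a b :=
    (hc (v a)).add hv'.absolutelyContinuousOnInterval_complex
  set G : ℝ → ℂ := fun x => u' x * V x + U x * v' x with hG
  have hGi : IntervalIntegrable G volume a b :=
    (hu'.mul_continuousOn hVac.continuousOn).add (hv'.continuousOn_mul hUac.continuousOn)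
  have hac : AbsolutelyContinuousOnInterval (fun x => U x * V x - ∫ t in a..x, G t) a b :=
    (hUac.fun_smul hVac).fun_sub hGi.absolutelyContinuousOnInterval_complex
  have hder : ∀ᵐ x, x ∈ uIcc a b → HasDerivAt (fun x => U x * V x - ∫ t in a..x, G t) 0 x := by
    filter_upwards [hu'.ae_hasDerivAt_integral, hv'.ae_hasDerivAt_integral,
      hGi.ae_hasDerivAt_integral] with x h1 h2 h3 hx
    have e1 : HasDerivAt U (u' x) x := (h1 hx a left_mem_uIcc).const_add _
    have e2 : HasDerivAt V (v' x) x := (h2 hx a left_mem_uIcc).const_add _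
    have := (e1.mul e2).sub (h3 hx a left_mem_uIcc)
    rwa [show u' x * V x + U x * v' x - G x = 0 from sub_self _] at this
  obtain ⟨C, hC⟩ := hac.const_of_ae_hasDerivAt_zero hder
  have ha := hC a left_mem_uIcc
  have hb := hC b right_mem_uIcc
  have hcongr : ∫ x in a..b, (u' x * v x + u x * v' x) = ∫ x in a..b, G x := by
    refine intervalIntegral.integral_congr fun x hx => ?_
    rw [uIcc_of_le hab] at hx
    simp only [hG, hU, hV, ← hu x hx, ← hv x hx]
  rw [hcongr]
  simp only [intervalIntegral.integral_same, sub_zero] at ha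
  simp only [hU, hV, ← hu b (right_mem_Icc.2 hab), ← hv b (right_mem_Icc.2 hab)] at hb
  simp only [hU, hV, intervalIntegral.integral_same, add_zero] at ha
  rw [ha, ← hb]; ring

theorem continuousOn_of_eq_primitive {f g : ℝ → ℂ} {a b : ℝ} (hab : a ≤ b)
    (hg : IntervalIntegrable g volume a b)
    (h : ∀ x ∈ Icc a b, f x = f a + ∫ t in a..x, g t) : ContinuousOn f (Icc a b) := by
  have := intervalIntegral.continuousOn_primitive_interval' hg left_mem_uIcc
  rw [uIcc_of_le hab] at this
  exact (continuousOn_const.add this).congr h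

theorem hasDerivWithinAt_of_eq_primitive {f g : ℝ → ℂ} {a b : ℝ} (hab : a ≤ b)
    (hg : ContinuousOn g (Icc a b)) (h : ∀ x ∈ Icc a b, f x = f a + ∫ t in a..x, g t)
    {x : ℝ} (hx : x ∈ Icc a b) : HasDerivWithinAt f (g x) (Icc a b) x := by
  set G : ℝ → ℂ := IccExtend hab ((Icc a b).domRestrict g) with hGdef
  have hGc : Continuous G := (continuousOn_iff_continuous_domRestrict.1 hg).Icc_extend'
  have hGe : ∀ y ∈ Icc a b, G y = g y := fun y hy => by
    rw [hGdef, IccExtend_of_mem _ _ hy]; rfl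
  have h1 : HasDerivAt (fun y => f a + ∫ t in a..y, G t) (G x) x :=
    (hGc.integral_hasStrictDerivAt a x).hasDerivAt.const_add _
  rw [hGe x hx] at h1
  have e : ∀ y ∈ Icc a b, f y = f a + ∫ t in a..y, G t := fun y hy => by
    rw [h y hy]
    congr 1
    refine intervalIntegral.integral_congr fun t ht => ?_
    rw [uIcc_of_le hy.1] at ht
    exact (hGe t ⟨ht.1, ht.2.trans hy.2⟩).symm
  exact h1.hasDerivWithinAt.congr e (e x hx)

namespace IsH2

variable {a b : ℝ} {f f' f'' g g' g'' : ℝ → ℂ}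

theorem intervalIntegrable_der2 (h : IsH2 a b f f' f'') (hab : a ≤ b) :
    IntervalIntegrable f'' volume a b :=
  (intervalIntegrable_iff_integrableOn_Icc_of_le hab).2 (h.memLp.integrable one_le_two)

theorem continuousOn_der (h : IsH2 a b f f' f'') (hab : a ≤ b) : ContinuousOn f' (Icc a b) :=
  continuousOn_of_eq_primitive hab (h.intervalIntegrable_der2 hab) h.der_eq

theorem intervalIntegrable_der (h : IsH2 a b f f' f'') (hab : a ≤ b) :
    IntervalIntegrable f' volume a b :=
  ContinuousOn.intervalIntegrable_of_Icc hab (h.continuousOn_der hab)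

theorem continuousOn_val (h : IsH2 a b f f' f'') (hab : a ≤ b) : ContinuousOn f (Icc a b) :=
  continuousOn_of_eq_primitive hab (h.intervalIntegrable_der hab) h.val_eq

theorem hasDerivWithinAt (h : IsH2 a b f f' f'') (hab : a ≤ b) {x : ℝ} (hx : x ∈ Icc a b) :
    HasDerivWithinAt f (f' x) (Icc a b) x :=
  hasDerivWithinAt_of_eq_primitive hab (h.continuousOn_der hab) h.val_eq hx

theorem mono (h : IsH2 a b f f' f'') {c : ℝ} (hac : a ≤ c) (hcb : c ≤ b) :
    IsH2 c b f f' f'' := by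
  have hab := hac.trans hcb
  have key : ∀ {F G : ℝ → ℂ}, IntervalIntegrable G volume a b →
      (∀ x ∈ Icc a b, F x = F a + ∫ t in a..x, G t) →
      ∀ x ∈ Icc c b, F x = F c + ∫ t in c..x, G t := by
    intro F G hG hF x hx
    have hc : c ∈ Icc a b := ⟨hac, hcb⟩
    have hx' : x ∈ Icc a b := ⟨hac.trans hx.1, hx.2⟩
    rw [hF x hx', hF c hc, add_assoc, intervalIntegral.integral_add_adjacent_intervals]
    · exact hG.mono_set (by rw [uIcc_of_le hac, uIcc_of_le hab]; exact Icc_subset_Icc_right hcb)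
    · exact hG.mono_set (by rw [uIcc_of_le hx.1, uIcc_of_le hab]; exact Icc_subset_Icc hac hx.2)
  exact ⟨key (h.intervalIntegrable_der hab) h.val_eq, key (h.intervalIntegrable_der2 hab) h.der_eq,
    h.memLp.mono_measure (Measure.restrict_mono (Icc_subset_Icc_left hac) le_rfl)⟩

theorem const_mul (h : IsH2 a b f f' f'') (c : ℂ) :
    IsH2 a b (fun x => c * f x) (fun x => c * f' x) (fun x => c * f'' x) where
  val_eq x hx := by rw [h.val_eq x hx, intervalIntegral.integral_const_mul, mul_add]
  der_eq x hx := by rw [h.der_eq x hx, intervalIntegral.integral_const_mul, mul_add]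
  memLp := h.memLp.const_mul c

theorem sub (hf : IsH2 a b f f' f'') (hg : IsH2 a b g g' g'') (hab : a ≤ b) :
    IsH2 a b (fun x => f x - g x) (fun x => f' x - g' x) (fun x => f'' x - g'' x) := by
  have hsub : ∀ {x}, x ∈ Icc a b → uIcc a x ⊆ uIcc a b := fun hx => by
    rw [uIcc_of_le hx.1, uIcc_of_le hab]; exact Icc_subset_Icc_right hx.2
  refine ⟨fun x hx => ?_, fun x hx => ?_, hf.memLp.sub hg.memLp⟩
  · rw [intervalIntegral.integral_sub ((hf.intervalIntegrable_der hab).mono_set (hsub hx))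
      ((hg.intervalIntegrable_der hab).mono_set (hsub hx)), hf.val_eq x hx, hg.val_eq x hx]
    ring
  · rw [intervalIntegral.integral_sub ((hf.intervalIntegrable_der2 hab).mono_set (hsub hx))
      ((hg.intervalIntegrable_der2 hab).mono_set (hsub hx)), hf.der_eq x hx, hg.der_eq x hx]
    ring

theorem conj (h : IsH2 a b f f' f'') :
    IsH2 a b (fun x => (starRingEnd ℂ) (f x)) (fun x => (starRingEnd ℂ) (f' x))
      (fun x => (starRingEnd ℂ) (f'' x)) where
  val_eq x hx := by
    rw [h.val_eq x hx, map_add, intervalIntegral.intervalIntegral_conj]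
  der_eq x hx := by
    rw [h.der_eq x hx, map_add, intervalIntegral.intervalIntegral_conj]
  memLp := h.memLp.star

theorem of_hasDerivAt (hf : ∀ x, HasDerivAt f (f' x) x)
    (hf' : ∀ x, HasDerivAt f' (f'' x) x) (hc : Continuous f'') : IsH2 a b f f' f'' where
  val_eq x _ := by
    rw [intervalIntegral.integral_eq_sub_of_hasDerivAt (fun y _ => hf y)
      ((continuous_iff_continuousAt.2 fun y => (hf' y).continuousAt).intervalIntegrable _ _)]
    ring
  der_eq x _ := by
    rw [intervalIntegral.integral_eq_sub_of_hasDerivAt (fun y _ => hf' y)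
      (hc.intervalIntegrable _ _)]
    ring
  memLp := by
    obtain ⟨C, hC⟩ := isCompact_Icc.exists_bound_of_continuousOn (s := Icc a b) hc.continuousOn
    exact MemLp.of_bound hc.aestronglyMeasurable C
      ((ae_restrict_iff' measurableSet_Icc).2 (ae_of_all _ hC))

/-- Green's identity: the bilinear Wronskian is the boundary form of the second derivative. -/
theorem green (hf : IsH2 a b f f' f'') (hg : IsH2 a b g g' g'') (hab : a ≤ b) :
    (∫ x in a..b, f x * g'' x) - ∫ x in a..b, f'' x * g x =
      (f b * g' b - f' b * g b) - (f a * g' a - f' a * g a) := by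
  have c1 := hf.continuousOn_val hab
  have c2 := hf.continuousOn_der hab
  have d1 := hg.continuousOn_val hab
  have d2 := hg.continuousOn_der hab
  rw [← uIcc_of_le hab] at c1 c2 d1 d2
  have i1 := hf.intervalIntegrable_der hab
  have i2 := hf.intervalIntegrable_der2 hab
  have j1 := hg.intervalIntegrable_der hab
  have j2 := hg.intervalIntegrable_der2 hab
  have h1 := integral_deriv_mul_of_eq_primitive hab i1 j2 hf.val_eq hg.der_eq
  have h2 := integral_deriv_mul_of_eq_primitive hab i2 j1 hf.der_eq hg.val_eq
  rw [intervalIntegral.integral_add (i1.mul_continuousOn d2) (j2.continuousOn_mul c1)] at h1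
  rw [intervalIntegral.integral_add (i2.mul_continuousOn d1) (j1.continuousOn_mul c2)] at h2
  linear_combination h1 - h2

end IsH2

/-! ### The square root on the upper half-plane -/

theorem csqrt_sq (z : ℂ) : csqrt z ^ 2 = z := by
  rw [csqrt, one_div]
  exact_mod_cast Complex.cpow_nat_inv_pow z two_ne_zero

theorem csqrt_re_pos {z : ℂ} (hz : 0 < z.im) : 0 < (csqrt z).re := by
  rw [csqrt, one_div, Complex.cpow_inv_two_re]
  have := Complex.abs_re_lt_norm.2 hz.ne'
  have := (abs_lt.1 this).1
  exact Real.sqrt_pos.2 (by linarith)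

theorem csqrt_im_pos {z : ℂ} (hz : 0 < z.im) : 0 < (csqrt z).im := by
  rw [csqrt, one_div, Complex.cpow_inv_two_im_eq_sqrt hz.le]
  have := Complex.abs_re_lt_norm.2 hz.ne'
  have := (abs_lt.1 this).2
  exact Real.sqrt_pos.2 (by linarith)

theorem csqrt_ne_zero {z : ℂ} (hz : 0 < z.im) : csqrt z ≠ 0 := fun h => by
  have := csqrt_im_pos hz
  simp [h] at this

theorem norm_csqrt (z : ℂ) : ‖csqrt z‖ = Real.sqrt ‖z‖ := by
  rw [eq_comm, Real.sqrt_eq_iff_mul_self_eq (norm_nonneg _) (norm_nonneg _), ← norm_mul, ← pow_two,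
    csqrt_sq]

theorem analyticAt_csqrt {z : ℂ} (hz : 0 < z.im) : AnalyticAt ℂ csqrt z := by
  have : z ∈ Complex.slitPlane := Or.inr hz.ne'
  exact analyticAt_id.cpow analyticAt_const this

/-! ### Solutions along an edge -/

/-- The solution of `-ψ'' = s² ψ` with `ψ 0 = A` and `ψ' 0 = B`. -/
noncomputable def edgeVal (s A B : ℂ) (x : ℝ) : ℂ :=
  A * Complex.cos (s * x) + B * (Complex.sin (s * x) / s)

/-- The derivative of `edgeVal s A B`. -/
noncomputable def edgeDer (s A B : ℂ) (x : ℝ) : ℂ :=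
  B * Complex.cos (s * x) - A * (s * Complex.sin (s * x))

section Edge

variable {s z A B : ℂ} {a b : ℝ} {f f' f'' : ℝ → ℂ}

@[simp] theorem edgeVal_zero : edgeVal s A B 0 = A := by simp [edgeVal]

@[simp] theorem edgeDer_zero : edgeDer s A B 0 = B := by simp [edgeDer]

theorem hasDerivAt_edgeVal (hs : s ≠ 0) (x : ℝ) :
    HasDerivAt (edgeVal s A B) (edgeDer s A B x) x := by
  have h : HasDerivAt (fun x : ℂ => s * x) s x := by
    simpa using (hasDerivAt_id (x : ℂ)).const_mul s
  have := ((h.ccos.const_mul A).add ((h.csin.div_const s).const_mul B)).comp_ofReal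
  refine this.congr_deriv ?_
  rw [edgeDer]; field_simp; ring

theorem hasDerivAt_edgeDer (x : ℝ) :
    HasDerivAt (edgeDer s A B) (-(s ^ 2) * edgeVal s A B x) x := by
  have h : HasDerivAt (fun x : ℂ => s * x) s x := by
    simpa using (hasDerivAt_id (x : ℂ)).const_mul s
  have := ((h.ccos.const_mul B).sub ((h.csin.const_mul s).const_mul A)).comp_ofReal
  refine this.congr_deriv ?_
  rw [edgeVal]
  by_cases hs : s = 0
  · simp [hs]
  · field_simp; ring

theorem continuous_edgeVal (hs : s ≠ 0) : Continuous (edgeVal s A B) :=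
  continuous_iff_continuousAt.2 fun x => (hasDerivAt_edgeVal hs x).continuousAt

theorem isH2_edge (hs : s ≠ 0) (hz : s ^ 2 = z) (a b : ℝ) :
    IsH2 a b (edgeVal s A B) (edgeDer s A B) (fun x => -z * edgeVal s A B x) := by
  subst hz
  exact IsH2.of_hasDerivAt (hasDerivAt_edgeVal hs) hasDerivAt_edgeDer
    (continuous_const.mul (continuous_edgeVal hs))

/-- The Wronskian of two solutions on an edge is constant. -/
theorem edge_wronskian (hs : s ≠ 0) (A B A' B' : ℂ) (x : ℝ) :
    edgeVal s A B x * edgeDer s A' B' x - edgeDer s A B x * edgeVal s A' B' x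
      = A * B' - B * A' := by
  have := Complex.sin_sq_add_cos_sq (s * x)
  have e : s * (Complex.sin (s * x) / s) = Complex.sin (s * x) := mul_div_cancel₀ _ hs
  simp only [edgeVal, edgeDer]
  linear_combination (A * B' - B * A') * (this + Complex.sin (s * x) * e)

/-- The energy identity: the boundary form `conj ψ * ψ'` of a solution changes along an edge by a
positive combination of `z` and `-1`. -/
theorem IsH2.energy (h : IsH2 a b f f' f'') (hab : a ≤ b)
    (he : ∀ᵐ x ∂(volume.restrict (Icc a b)), -f'' x = z * f x) :
    (starRingEnd ℂ) (f a) * f' a = (starRingEnd ℂ) (f b) * f' b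
      + z * ((∫ x in a..b, ‖f x‖ ^ 2 : ℝ) : ℂ) - ((∫ x in a..b, ‖f' x‖ ^ 2 : ℝ) : ℂ) := by
  have c1 := h.conj.continuousOn_val hab
  have c2 := h.continuousOn_der hab
  rw [← uIcc_of_le hab] at c1 c2
  have i1 := h.conj.intervalIntegrable_der hab
  have j2 := h.intervalIntegrable_der2 hab
  have h1 := integral_deriv_mul_of_eq_primitive hab i1 j2 h.conj.val_eq h.der_eq
  rw [intervalIntegral.integral_add (i1.mul_continuousOn c2) (j2.continuousOn_mul c1)] at h1
  have e1 : ∫ x in a..b, (starRingEnd ℂ) (f' x) * f' x = ((∫ x in a..b, ‖f' x‖ ^ 2 : ℝ) : ℂ) := by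
    rw [← intervalIntegral.integral_ofReal]
    refine intervalIntegral.integral_congr fun x _ => ?_
    simp [Complex.conj_mul']
  have e2 : ∫ x in a..b, (starRingEnd ℂ) (f x) * f'' x
      = -z * ((∫ x in a..b, ‖f x‖ ^ 2 : ℝ) : ℂ) := by
    rw [← intervalIntegral.integral_ofReal, ← intervalIntegral.integral_const_mul]
    refine intervalIntegral.integral_congr_ae ?_
    filter_upwards [(ae_restrict_iff' measurableSet_Icc).1 he] with t ht hty
    rw [uIoc_of_le hab] at hty
    have := ht ⟨hty.1.le, hty.2⟩
    push_cast
    rw [← Complex.conj_mul']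
    linear_combination -(starRingEnd ℂ) (f t) * this
  rw [e1, e2] at h1
  linear_combination h1

theorem IsH2.im_energy (h : IsH2 a b f f' f'') (hab : a ≤ b)
    (he : ∀ᵐ x ∂(volume.restrict (Icc a b)), -f'' x = z * f x) :
    ((starRingEnd ℂ) (f a) * f' a).im = ((starRingEnd ℂ) (f b) * f' b).im
      + z.im * ∫ x in a..b, ‖f x‖ ^ 2 := by
  rw [h.energy hab he]
  simp only [Complex.sub_im, Complex.add_im, Complex.im_mul_ofReal, Complex.ofReal_im, sub_zero]

theorem integral_norm_sq_pos (hab : a < b) (hf : ContinuousOn f (Icc a b)) {c : ℝ}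
    (hc : c ∈ Icc a b) (h0 : f c ≠ 0) : 0 < ∫ x in a..b, ‖f x‖ ^ 2 :=
  intervalIntegral.integral_pos hab (hf.norm.pow 2) (fun _ _ => by positivity)
    ⟨c, hc, by positivity⟩

theorem integral_norm_sq_nonneg (hab : a ≤ b) : 0 ≤ ∫ x in a..b, ‖f x‖ ^ 2 :=
  intervalIntegral.integral_nonneg hab fun _ _ => by positivity

end Edge

/-! ### The cone of Weyl–Titchmarsh values and the backward flow -/

/-- The cone of complex numbers `r` such that `r` and `r / z` lie in the closed upper half-plane.
It is the convex cone spanned by `z` and `-1`. -/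
def wtCone (z : ℂ) : Set ℂ := {r | 0 ≤ r.im ∧ 0 ≤ (r * (starRingEnd ℂ) z).im}

section Cone

variable {z r ρ : ℂ} {l : ℝ}

theorem isClosed_wtCone (z : ℂ) : IsClosed (wtCone z) :=
  (isClosed_le continuous_const Complex.continuous_im).inter
    (isClosed_le continuous_const (Complex.continuous_im.comp (continuous_id.mul continuous_const)))

theorem sum_mem_wtCone {ι : Type*} (t : Finset ι) {f : ι → ℂ} (h : ∀ i ∈ t, f i ∈ wtCone z) :
    ∑ i ∈ t, f i ∈ wtCone z := by
  refine ⟨?_, ?_⟩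
  · rw [Complex.im_sum]; exact Finset.sum_nonneg fun i hi => (h i hi).1
  · rw [Finset.sum_mul, Complex.im_sum]; exact Finset.sum_nonneg fun i hi => (h i hi).2

theorem I_mul_csqrt_mem_wtCone (hz : 0 < z.im) : Complex.I * csqrt z ∈ wtCone z := by
  have h := csqrt_sq z
  have hr := csqrt_re_pos hz
  set s := csqrt z
  have h1 := congrArg Complex.re h
  have h2 := congrArg Complex.im h
  simp only [pow_two, Complex.mul_re, Complex.mul_im] at h1 h2
  refine ⟨by simpa using hr.le, ?_⟩
  simp only [Complex.mul_im, Complex.mul_re, Complex.I_re, Complex.I_im, Complex.conj_re,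
    Complex.conj_im]
  rw [← h1, ← h2]
  have : 0 ≤ s.re * (s.re ^ 2 + s.im ^ 2) := by positivity
  linarith

/-- Elements of the cone make an angle of at most a right angle with `i √z`. -/
theorem norm_sub_le_norm_add_of_mem_wtCone (hz : 0 < z.im) (h : ρ ∈ wtCone z) :
    ‖Complex.I * csqrt z - ρ‖ ≤ ‖Complex.I * csqrt z + ρ‖ := by
  have hs := csqrt_sq z
  have hr := csqrt_re_pos hz
  set s := csqrt z
  have h1 := congrArg Complex.re hs
  have h2 := congrArg Complex.im hs
  simp only [pow_two, Complex.mul_re, Complex.mul_im] at h1 h2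
  obtain ⟨p, q⟩ := h
  simp only [Complex.mul_im, Complex.conj_re, Complex.conj_im] at q
  rw [← h1, ← h2] at q
  have key : 0 ≤ s.re * ρ.im - s.im * ρ.re := by
    have : 0 ≤ 2 * s.re * (s.re * ρ.im - s.im * ρ.re) := by
      nlinarith [mul_nonneg p (add_nonneg (sq_nonneg s.re) (sq_nonneg s.im))]
    exact nonneg_of_mul_nonneg_right this (by positivity)
  rw [← sq_le_sq₀ (norm_nonneg _) (norm_nonneg _), ← Complex.normSq_eq_norm_sq,
    ← Complex.normSq_eq_norm_sq, Complex.normSq_apply, Complex.normSq_apply]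
  simp
  nlinarith

theorem one_sub_exp_pos {κ : ℝ} (hl : 0 < l) (hκ : 0 < κ) :
    0 < 1 - Real.exp (-2 * l * κ) := by
  have : Real.exp (-2 * l * κ) < 1 := by
    rw [Real.exp_lt_one_iff]; nlinarith [mul_pos hl hκ]
  linarith

theorem div_one_sub_exp_anti {c κ l' : ℝ} (hc : 0 ≤ c) (hκ : 0 < κ) (hl : 0 < l) (h : l ≤ l') :
    c / (1 - Real.exp (-2 * l' * κ)) ≤ c / (1 - Real.exp (-2 * l * κ)) := by
  refine div_le_div_of_nonneg_left hc (one_sub_exp_pos hl hκ) (sub_le_sub_left ?_ 1)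
  exact Real.exp_le_exp.2 (mul_le_mul_of_nonneg_right (by linarith) hκ.le)

/-- `r` at the near end and `ρ` at the far end of an edge of length `l` are values of the
logarithmic derivative of the same solution of `-ψ'' = z ψ`, in a form free of denominators. -/
def EdgeRel (z : ℂ) (l : ℝ) (r ρ : ℂ) : Prop :=
  edgeDer (csqrt z) 1 r l = ρ * edgeVal (csqrt z) 1 r l

/-- Comparison of the solution with the outgoing and incoming waves at both ends of the edge, which
are damped by opposite exponentials. -/
theorem EdgeRel.norm_le (hz : 0 < z.im) (hl : 0 < l) (hρ : ρ ∈ wtCone z) (h : EdgeRel z l r ρ) :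
    ‖r‖ ≤ 2 * Real.sqrt ‖z‖ / (1 - Real.exp (-2 * l * (csqrt z).im)) := by
  have hs := csqrt_ne_zero hz
  have hκ := csqrt_im_pos hz
  rw [← norm_csqrt]
  have hc := norm_sub_le_norm_add_of_mem_wtCone hz hρ
  rw [EdgeRel] at h
  set s := csqrt z
  set c := edgeVal s 1 r l with hcdef
  set E := Complex.exp (s * l * Complex.I) with hE
  have hE1 : Complex.cos (s * l) + Complex.sin (s * l) * Complex.I = E :=
    (Complex.exp_mul_I _).symm
  have hE2 : Complex.cos (s * l) - Complex.sin (s * l) * Complex.I = E⁻¹ := by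
    rw [hE, ← Complex.exp_neg, ← neg_mul, Complex.exp_mul_I, Complex.cos_neg, Complex.sin_neg]
    ring
  have hI := Complex.I_sq
  -- the amplitudes of the incoming and the outgoing wave at the two ends
  have e1 : (Complex.I * s - ρ) * c = (Complex.I * s - r) * E⁻¹ := by
    rw [sub_mul, ← h, ← hE2, hcdef, edgeVal, edgeDer]
    field_simp
    linear_combination (s * Complex.sin (s * l)) * hI
  have e2 : (Complex.I * s + ρ) * c = (Complex.I * s + r) * E := by
    rw [add_mul, ← h, ← hE1, hcdef, edgeVal, edgeDer]
    field_simp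
    linear_combination (-s * Complex.sin (s * l)) * hI
  have hEn : ‖E‖ = Real.exp (-(l * s.im)) := by
    rw [hE, Complex.norm_exp]; congr 1; simp; ring
  set τ := Real.exp (-(l * s.im)) with hτ
  have hτ0 : 0 < τ := Real.exp_pos _
  have hτ2 : Real.exp (-2 * l * s.im) = τ ^ 2 := by
    rw [hτ, ← Real.exp_nat_mul]; congr 1; push_cast; ring
  have hτ1 : τ ^ 2 < 1 := by
    rw [← hτ2]; linarith [one_sub_exp_pos hl hκ]
  have n1 := congrArg norm e1
  have n2 := congrArg norm e2
  rw [norm_mul, norm_mul, norm_inv, hEn] at n1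
  rw [norm_mul, norm_mul, hEn] at n2
  have n3 : ‖Complex.I * s - r‖ ≤ ‖Complex.I * s + r‖ * τ ^ 2 := by
    have : ‖Complex.I * s - r‖ * τ⁻¹ ≤ ‖Complex.I * s + r‖ * τ := by
      rw [← n1, ← n2]; exact mul_le_mul_of_nonneg_right hc (norm_nonneg _)
    rw [mul_inv_le_iff₀ hτ0] at this
    linarith
  have hIs : ‖Complex.I * s‖ = ‖s‖ := by simp
  have t1 : ‖r‖ - ‖s‖ ≤ ‖Complex.I * s - r‖ := by
    rw [← hIs, norm_sub_rev]; exact norm_sub_norm_le _ _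
  have t2 : ‖Complex.I * s + r‖ ≤ ‖s‖ + ‖r‖ := by rw [← hIs]; exact norm_add_le _ _
  rw [hτ2, le_div_iff₀ (by linarith)]
  have t3 := mul_le_mul_of_nonneg_right t2 (sq_nonneg τ)
  have t4 := mul_le_of_le_one_right (norm_nonneg s) hτ1.le
  nlinarith

theorem EdgeRel.edgeVal_ne_zero (hz : 0 < z.im) (h : EdgeRel z l r ρ) :
    edgeVal (csqrt z) 1 r l ≠ 0 := by
  intro h0
  rw [EdgeRel, h0, mul_zero] at h
  have := edge_wronskian (csqrt_ne_zero hz) 1 r 0 1 l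
  rw [h0, h] at this
  simp at this

/-- Energy balance for a Weyl–Titchmarsh value along an edge. -/
theorem EdgeRel.im_eq (hz : 0 < z.im) (h : EdgeRel z l r ρ) {x : ℝ} (hx : x ≤ l) :
    ((starRingEnd ℂ) (edgeVal (csqrt z) 1 r x) * edgeDer (csqrt z) 1 r x).im =
      ρ.im * ‖edgeVal (csqrt z) 1 r l‖ ^ 2 +
        z.im * ∫ t in x..l, ‖edgeVal (csqrt z) 1 r t‖ ^ 2 := by
  have := (isH2_edge (A := 1) (B := r) (csqrt_ne_zero hz) (csqrt_sq z) x l).im_energy hx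
    (ae_of_all _ fun t => by ring)
  rw [this, h, mul_left_comm, Complex.conj_mul', ← Complex.ofReal_pow, Complex.im_mul_ofReal]

/-- The flux is positive before the far end, so the solution does not vanish there. -/
theorem EdgeRel.im_pos_of_lt (hz : 0 < z.im) (hρ : 0 ≤ ρ.im) (h : EdgeRel z l r ρ) {x : ℝ}
    (hx : x < l) :
    0 < ((starRingEnd ℂ) (edgeVal (csqrt z) 1 r x) * edgeDer (csqrt z) 1 r x).im := by
  rw [h.im_eq hz hx.le]
  have := integral_norm_sq_pos hx (continuous_edgeVal (csqrt_ne_zero hz)).continuousOn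
    (right_mem_Icc.2 hx.le) (h.edgeVal_ne_zero hz)
  have := mul_pos hz this
  positivity

/-- The backward flow: the value at the near end of an edge of length `l` of the logarithmic
derivative of the solution whose logarithmic derivative at the far end is `ρ`. -/
noncomputable def backward (z : ℂ) (l : ℝ) (ρ : ℂ) : ℂ :=
  edgeDer (csqrt z) 1 (-ρ) l * (-1) / edgeVal (csqrt z) 1 (-ρ) l

/-- The backward flow is well defined on the cone and preserves it: by the energy identity it adds a
positive multiple of `z` and a nonnegative multiple of `-1`, up to a positive factor. Here
`edgeVal (csqrt z) 1 (-ρ)` is the reflected solution, with value `1` and slope `ρ` at the far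
end. -/
theorem backward_mem_wtCone (hz : 0 < z.im) (hl : 0 < l) (hρ : ρ ∈ wtCone z) :
    edgeVal (csqrt z) 1 (-ρ) l ≠ 0 ∧ backward z l ρ ∈ wtCone z := by
  have hs := csqrt_ne_zero hz
  have h := (isH2_edge (A := 1) (B := -ρ) hs (csqrt_sq z) 0 l)
  have he := h.energy (z := z) hl.le (ae_of_all _ fun t => by ring)
  have hP := integral_norm_sq_pos hl (continuous_edgeVal (A := 1) (B := -ρ) hs).continuousOn
    (left_mem_Icc.2 hl.le) (by simp)
  have hQ := integral_norm_sq_nonneg (f := edgeDer (csqrt z) 1 (-ρ)) hl.le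
  rw [edgeVal_zero, edgeDer_zero] at he
  set P := ∫ x in (0:ℝ)..l, ‖edgeVal (csqrt z) 1 (-ρ) x‖ ^ 2
  set Q := ∫ x in (0:ℝ)..l, ‖edgeDer (csqrt z) 1 (-ρ) x‖ ^ 2
  rw [backward]
  set D := edgeVal (csqrt z) 1 (-ρ) l
  set N := edgeDer (csqrt z) 1 (-ρ) l
  have hDN : (starRingEnd ℂ) D * (N * (-1)) = ρ + z * P - Q := by
    linear_combination he + ρ * (map_one (starRingEnd ℂ))
  have hD : D ≠ 0 := by
    intro h0
    rw [h0, map_zero, zero_mul] at hDN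
    have := congrArg Complex.im hDN
    simp only [Complex.sub_im, Complex.add_im, Complex.im_mul_ofReal, Complex.ofReal_im,
      Complex.zero_im] at this
    have h2 := mul_pos hz hP
    have h3 := hρ.1
    linarith
  refine ⟨hD, ?_⟩
  have hdiv : N * (-1) / D = (ρ + z * P - Q) * ((‖D‖ ^ 2)⁻¹ : ℝ) := by
    rw [← hDN]
    push_cast
    rw [← Complex.conj_mul']
    have : (starRingEnd ℂ) D ≠ 0 := by simpa using hD
    field_simp
  rw [hdiv]
  refine ⟨?_, ?_⟩
  · rw [Complex.im_mul_ofReal]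
    refine mul_nonneg ?_ (by positivity)
    simp only [Complex.sub_im, Complex.add_im, Complex.im_mul_ofReal, Complex.ofReal_im]
    have h2 := mul_pos hz hP
    have h3 := hρ.1
    linarith
  · rw [mul_right_comm, Complex.im_mul_ofReal]
    refine mul_nonneg ?_ (by positivity)
    have : (ρ + z * P - Q) * (starRingEnd ℂ) z =
        ρ * (starRingEnd ℂ) z + ((‖z‖ ^ 2 * P : ℝ) : ℂ) - (starRingEnd ℂ) z * Q := by
      push_cast; rw [← Complex.mul_conj']; ring
    rw [this]
    simp only [Complex.sub_im, Complex.add_im, Complex.im_mul_ofReal, Complex.ofReal_im,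
      Complex.conj_im]
    have h2 := mul_nonneg hz.le hQ
    have h3 := hρ.2
    linarith

theorem edgeRel_backward (hz : 0 < z.im) (hl : 0 < l) (hρ : ρ ∈ wtCone z) :
    EdgeRel z l (backward z l ρ) ρ := by
  have hs := csqrt_ne_zero hz
  have hD := (backward_mem_wtCone hz hl hρ).1
  rw [EdgeRel, backward]
  set N := edgeDer (csqrt z) 1 (-ρ) l with hN
  set D := edgeVal (csqrt z) 1 (-ρ) l with hDdef
  have h1 : edgeVal (csqrt z) 1 (N * (-1) / D) l = 1 / D := by
    have h := edge_wronskian hs 1 (-ρ) 0 1 l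
    have e : edgeVal (csqrt z) 1 (N * (-1) / D) l =
      (D * edgeDer (csqrt z) 0 1 l - N * edgeVal (csqrt z) 0 1 l) / D := by
      rw [sub_div, mul_div_cancel_left₀ _ hD]; simp only [edgeVal, edgeDer]; ring
    rw [e, h]; simp
  have h2 : edgeDer (csqrt z) 1 (N * (-1) / D) l = ρ / D := by
    have h := edge_wronskian hs 1 (-ρ) 1 0 l
    have e : edgeDer (csqrt z) 1 (N * (-1) / D) l =
      (D * edgeDer (csqrt z) 1 0 l - N * edgeVal (csqrt z) 1 0 l) / D := by
      rw [sub_div, mul_div_cancel_left₀ _ hD]; simp only [edgeVal, edgeDer]; ring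
    rw [e, h]; simp
  rw [h1, h2]; ring

end Cone

/-! ### Levels of the tree -/

/-- The edges of generation `n`. -/
def treeLevel (K : ℕ) : ℕ → Finset (TreeEdge K)
  | 0 => {[]}
  | n + 1 => ((treeLevel K n) ×ˢ Finset.univ).image fun p : TreeEdge K × Fin K => p.2 :: p.1

/-- The edges of generation less than `n`. -/
def treeBall (K n : ℕ) : Finset (TreeEdge K) := (Finset.range n).biUnion (treeLevel K)

section Levels

variable {K : ℕ}

theorem mem_treeLevel {n : ℕ} {e : TreeEdge K} : e ∈ treeLevel K n ↔ e.length = n := by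
  induction n generalizing e with
  | zero => simp [treeLevel]
  | succ n ih =>
    simp only [treeLevel, Finset.mem_image, Finset.mem_product, ih, Finset.mem_univ, and_true]
    constructor
    · rintro ⟨⟨f, i⟩, hf, rfl⟩
      simpa using hf
    · intro h
      cases e with
      | nil => simp at h
      | cons i f => exact ⟨(f, i), by simpa using h, rfl⟩

theorem sum_treeLevel_succ {M : Type*} [AddCommMonoid M] (n : ℕ) (F : TreeEdge K → M) :
    ∑ e ∈ treeLevel K (n + 1), F e = ∑ e ∈ treeLevel K n, ∑ i : Fin K, F (i :: e) := by
  rw [treeLevel, Finset.sum_image, Finset.sum_product]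
  rintro ⟨a, i⟩ _ ⟨b, j⟩ _ h
  simp only [List.cons.injEq] at h
  simp [h.1, h.2]

theorem sum_treeBall {M : Type*} [AddCommMonoid M] (n : ℕ) (F : TreeEdge K → M) :
    ∑ e ∈ treeBall K n, F e = ∑ k ∈ Finset.range n, ∑ e ∈ treeLevel K k, F e := by
  refine Finset.sum_biUnion fun i _ j _ hij => Finset.disjoint_left.2 fun e hi hj => hij ?_
  rw [← mem_treeLevel.1 hi, ← mem_treeLevel.1 hj]

theorem sum_treeBall_succ {M : Type*} [AddCommMonoid M] (n : ℕ) (F : TreeEdge K → M) :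
    ∑ e ∈ treeBall K (n + 1), F e = ∑ e ∈ treeBall K n, F e + ∑ e ∈ treeLevel K n, F e := by
  rw [sum_treeBall, sum_treeBall, Finset.sum_range_succ]

theorem mem_treeBall {n : ℕ} {e : TreeEdge K} : e ∈ treeBall K n ↔ e.length < n := by
  simp [treeBall, mem_treeLevel]

theorem tendsto_treeBall : Tendsto (treeBall K) atTop atTop := by
  refine tendsto_atTop_finset_of_monotone (fun m n hmn e he => ?_) fun e => ?_
  · rw [mem_treeBall] at he ⊢; omega
  · exact ⟨e.length + 1, mem_treeBall.2 (Nat.lt_succ_self _)⟩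

/-- Telescoping along the generations: a balance law at every edge adds up over the ball. -/
theorem sum_treeBall_telescope {M : Type*} [AddCommGroup M] {F G : TreeEdge K → M}
    (h : ∀ e, F e = G e - ∑ i : Fin K, G (i :: e)) (n : ℕ) :
    ∑ e ∈ treeBall K n, F e = G [] - ∑ e ∈ treeLevel K n, G e := by
  induction n with
  | zero => simp [treeBall, treeLevel]
  | succ n ih =>
    rw [sum_treeBall_succ, ih, sum_treeLevel_succ, Finset.sum_congr rfl fun e _ => h e,
      Finset.sum_sub_distrib]
    abel

theorem tendsto_sum_treeLevel_zero {F : TreeEdge K → ℝ} (h : Summable F) :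
    Tendsto (fun n => ∑ e ∈ treeLevel K n, F e) atTop (𝓝 0) := by
  have h1 := h.hasSum.comp tendsto_treeBall
  have h2 := ((tendsto_add_atTop_iff_nat 1).2 h1).sub h1
  rw [sub_self] at h2
  refine h2.congr fun n => ?_
  simp only [Function.comp_apply, sum_treeBall_succ]
  ring

end Levels

/-! ### Families of Weyl–Titchmarsh values -/

/-- A family of candidate Weyl–Titchmarsh values at the near ends of the edges: they lie in the
cone, follow the Riccati flow along each edge, and satisfy the Kirchhoff condition. -/
def IsWTFamily {K : ℕ} (L : TreeEdge K → ℝ) (z : ℂ) (r : TreeEdge K → ℂ) : Prop :=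
  ∀ e, r e ∈ wtCone z ∧ EdgeRel z (L e) (r e) (∑ i : Fin K, r (i :: e))

section Families

variable {K : ℕ} {L : TreeEdge K → ℝ} {z : ℂ} {r : TreeEdge K → ℂ}

/-- Bounded approximate families have limits along ultrafilters, and these are families. -/
theorem exists_limit_wtFamily {ι : Type*} (U : Ultrafilter ι) {Ls : ι → TreeEdge K → ℝ}
    (hL : ∀ e, Tendsto (fun i => Ls i e) U (𝓝 (L e))) {rs : ι → TreeEdge K → ℂ}
    (B : TreeEdge K → ℝ) (hB : ∀ e, ∀ᶠ i in U, ‖rs i e‖ ≤ B e)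
    (hr : ∀ e, ∀ᶠ i in U, rs i e ∈ wtCone z ∧
      EdgeRel z (Ls i e) (rs i e) (∑ j : Fin K, rs i (j :: e))) :
    ∃ r, IsWTFamily L z r ∧ ∀ e, Tendsto (fun i => rs i e) U (𝓝 (r e)) := by
  have hlim : ∀ e, ∃ w, Tendsto (fun i => rs i e) U (𝓝 w) := fun e => by
    obtain ⟨w, -, hw⟩ := (isCompact_closedBall (0 : ℂ) (B e)).ultrafilter_le_nhds'
      (U.map fun i => rs i e) ((hB e).mono fun i hi => mem_closedBall_zero_iff.2 hi)
    exact ⟨w, hw⟩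
  choose r h using hlim
  refine ⟨r, fun e => ⟨(isClosed_wtCone z).mem_of_tendsto (h e) ((hr e).mono fun i hi => hi.1), ?_⟩,
    h⟩
  have hLe : Tendsto (fun i => csqrt z * ((Ls i e : ℝ) : ℂ)) U (𝓝 (csqrt z * (L e : ℂ))) :=
    ((Complex.continuous_ofReal.tendsto _).comp (hL e)).const_mul _
  have hcos := (Complex.continuous_cos.tendsto _).comp hLe
  have hsin := (Complex.continuous_sin.tendsto _).comp hLe
  have hV : Tendsto (fun i => edgeVal (csqrt z) 1 (rs i e) (Ls i e)) U
      (𝓝 (edgeVal (csqrt z) 1 (r e) (L e))) :=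
    (hcos.const_mul 1).add ((h e).mul (hsin.div_const _))
  have hD : Tendsto (fun i => edgeDer (csqrt z) 1 (rs i e) (Ls i e)) U
      (𝓝 (edgeDer (csqrt z) 1 (r e) (L e))) :=
    ((h e).mul hcos).sub ((hsin.const_mul _).const_mul 1)
  have hS : Tendsto (fun i => ∑ j : Fin K, rs i (j :: e)) U (𝓝 (∑ j : Fin K, r (j :: e))) :=
    tendsto_finsetSum _ fun j _ => h (j :: e)
  exact tendsto_nhds_unique_of_eventuallyEq hD (hS.mul hV) ((hr e).mono fun i hi => hi.2)

/-- The values at the near ends of the edges obtained from `n` backward steps, starting from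
`i √z`. -/
noncomputable def wtApprox (L : TreeEdge K → ℝ) (z : ℂ) : ℕ → TreeEdge K → ℂ
  | 0, _ => Complex.I * csqrt z
  | n + 1, e => backward z (L e) (∑ i : Fin K, wtApprox L z n (i :: e))

theorem wtApprox_mem (hL : ∀ e, 0 < L e) (hz : 0 < z.im) (n : ℕ) (e : TreeEdge K) :
    wtApprox L z n e ∈ wtCone z := by
  induction n generalizing e with
  | zero => exact I_mul_csqrt_mem_wtCone hz
  | succ n ih => exact (backward_mem_wtCone hz (hL e) (sum_mem_wtCone _ fun _ _ => ih _)).2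

theorem edgeRel_wtApprox (hL : ∀ e, 0 < L e) (hz : 0 < z.im) (n : ℕ) (e : TreeEdge K) :
    EdgeRel z (L e) (wtApprox L z (n + 1) e) (∑ i : Fin K, wtApprox L z n (i :: e)) :=
  edgeRel_backward hz (hL e) (sum_mem_wtCone _ fun _ _ => wtApprox_mem hL hz n _)

theorem norm_wtApprox_le (hL : ∀ e, 0 < L e) (hz : 0 < z.im) (n : ℕ) (e : TreeEdge K) :
    ‖wtApprox L z (n + 1) e‖ ≤
      2 * Real.sqrt ‖z‖ / (1 - Real.exp (-2 * L e * (csqrt z).im)) :=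
  (edgeRel_wtApprox hL hz n e).norm_le hz (hL e)
    (sum_mem_wtCone _ fun _ _ => wtApprox_mem hL hz n _)

theorem analyticAt_wtApprox (hL : ∀ e, 0 < L e) (hz : 0 < z.im) (n : ℕ) (e : TreeEdge K) :
    AnalyticAt ℂ (fun w => wtApprox L w n e) z := by
  have hs := analyticAt_csqrt hz
  induction n generalizing e with
  | zero => exact analyticAt_const.mul hs
  | succ n ih =>
    have hsum : AnalyticAt ℂ (fun w => -∑ i : Fin K, wtApprox L w n (i :: e)) z :=
      (Finset.analyticAt_fun_sum _ fun i _ => ih _).neg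
    have harg : AnalyticAt ℂ (fun w => csqrt w * ((L e : ℝ) : ℂ)) z := hs.mul analyticAt_const
    have hcos : AnalyticAt ℂ (fun w => Complex.cos (csqrt w * ((L e : ℝ) : ℂ))) z :=
      (Complex.differentiable_cos.analyticAt _).fun_comp harg
    have hsin : AnalyticAt ℂ (fun w => Complex.sin (csqrt w * ((L e : ℝ) : ℂ))) z :=
      (Complex.differentiable_sin.analyticAt _).fun_comp harg
    have hD := (backward_mem_wtCone hz (hL e)
      (sum_mem_wtCone Finset.univ fun i _ => wtApprox_mem hL hz n (i :: e))).1
    exact (((hsum.mul hcos).sub (analyticAt_const.mul (hs.mul hsin))).mul analyticAt_const).div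
      ((analyticAt_const.mul hcos).add (hsum.mul (hsin.div hs (csqrt_ne_zero hz)))) hD

/-- Every ultrafilter limit of the approximations is attained by a family. Near the edge `e` the
`n`-th approximation uses `n - e.length` backward steps, so that it is consistent across vertices. -/
theorem exists_wtFamily_limit (hL : ∀ e, 0 < L e) (hz : 0 < z.im) (U : Ultrafilter ℕ)
    (hU : (U : Filter ℕ) ≤ atTop) : ∃ r, IsWTFamily L z r ∧
      ∀ e, Tendsto (fun n => wtApprox L z (n - e.length) e) U (𝓝 (r e)) := by
  have hev : ∀ e : TreeEdge K, ∀ᶠ n in U, e.length < n := fun e =>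
    hU (eventually_gt_atTop e.length)
  refine exists_limit_wtFamily U (Ls := fun _ => L) (fun e => tendsto_const_nhds)
    (fun e => 2 * Real.sqrt ‖z‖ / (1 - Real.exp (-2 * L e * (csqrt z).im)))
    (rs := fun n e => wtApprox L z (n - e.length) e) (fun e => ?_) (fun e => ?_)
  · filter_upwards [hev e] with n hn
    obtain ⟨m, rfl⟩ := Nat.exists_eq_add_of_lt hn
    rw [show e.length + m + 1 - e.length = m + 1 by omega]
    exact norm_wtApprox_le hL hz m e
  · filter_upwards [hev e] with n hn
    obtain ⟨m, rfl⟩ := Nat.exists_eq_add_of_lt hn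
    have e1 : e.length + m + 1 - e.length = m + 1 := by omega
    have e2 : ∀ i : Fin K, e.length + m + 1 - (i :: e).length = m := fun i => by
      rw [List.length_cons]; omega
    simp only [e1, e2]
    exact ⟨wtApprox_mem hL hz _ _, edgeRel_wtApprox hL hz m e⟩

theorem exists_wtFamily (hL : ∀ e, 0 < L e) (hz : 0 < z.im) : ∃ r, IsWTFamily L z r :=
  (exists_wtFamily_limit hL hz (Filter.hyperfilter ℕ) Nat.hyperfilter_le_atTop).imp fun _ h => h.1

theorem tendsto_wtApprox (hL : ∀ e, 0 < L e) (hz : 0 < z.im)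
    (huniq : ∀ r', IsWTFamily L z r' → r' = r) (e : TreeEdge K) :
    Tendsto (fun n => wtApprox L z n e) atTop (𝓝 (r e)) := by
  have h : Tendsto (fun n => wtApprox L z (n - e.length) e) atTop (𝓝 (r e)) := by
    rw [tendsto_iff_ultrafilter]
    intro U hU
    obtain ⟨r', hr', h⟩ := exists_wtFamily_limit hL hz U hU
    exact huniq r' hr' ▸ h e
  have h2 := h.comp (tendsto_add_atTop_nat e.length)
  refine h2.congr fun n => ?_
  simp

/-! ### Pointwise limits of analytic functions -/

/-- Pointwise limits of locally uniformly bounded analytic functions are analytic: pass to the limit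
in Cauchy's integral formula. -/
theorem analyticAt_of_tendsto_of_bound {F : ℕ → ℂ → ℂ} {f : ℂ → ℂ} {U : Set ℂ} (hU : IsOpen U)
    (hF : ∀ n, ∀ w ∈ U, AnalyticAt ℂ (F n) w)
    (hf : ∀ w ∈ U, Tendsto (fun n => F n w) atTop (𝓝 (f w))) {b : ℂ → ℝ} (hb : ContinuousOn b U)
    (hFb : ∀ n, ∀ w ∈ U, ‖F n w‖ ≤ b w) {c : ℂ} (hc : c ∈ U) : AnalyticAt ℂ f c := by
  obtain ⟨R, hR, hRU⟩ := Metric.nhds_basis_closedBall.mem_iff.1 (hU.mem_nhds hc)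
  lift R to NNReal using hR.le
  have hsph : ∀ θ, circleMap c R θ ∈ U := fun θ =>
    hRU (Metric.sphere_subset_closedBall (circleMap_mem_sphere c R.2 θ))
  obtain ⟨C, hC⟩ := (isCompact_closedBall c R).exists_bound_of_continuousOn (hb.mono hRU)
  have hFC : ∀ n, ∀ w ∈ Metric.closedBall c R, ‖F n w‖ ≤ C := fun n w hw =>
    (hFb n w (hRU hw)).trans ((le_abs_self _).trans (hC w hw))
  have hcont : ∀ n, Continuous fun θ => F n (circleMap c R θ) := fun n =>
    continuous_iff_continuousAt.2 fun θ =>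
      (hF n _ (hsph θ)).continuousAt.comp (continuous_circleMap c R).continuousAt
  have hlim : ∀ θ, Tendsto (fun n => F n (circleMap c R θ)) atTop (𝓝 (f (circleMap c R θ))) :=
    fun θ => hf _ (hsph θ)
  have hmeas : StronglyMeasurable fun θ => f (circleMap c R θ) :=
    stronglyMeasurable_of_tendsto atTop (fun n => (hcont n).stronglyMeasurable)
      (tendsto_pi_nhds.2 hlim)
  have hfC : ∀ θ, ‖f (circleMap c R θ)‖ ≤ C := fun θ =>
    le_of_tendsto (hlim θ).norm (Eventually.of_forall fun n =>
      hFC n _ (Metric.sphere_subset_closedBall (circleMap_mem_sphere c R.2 θ)))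
  have hint : CircleIntegrable f c R := by
    rw [CircleIntegrable, intervalIntegrable_iff]
    exact Measure.integrableOn_of_bounded (M := C) (by simp [ENNReal.mul_eq_top])
      hmeas.aestronglyMeasurable (ae_of_all _ hfC)
  have hps := hasFPowerSeriesOn_cauchy_integral hint (by exact_mod_cast hR)
  refine hps.analyticAt.congr ?_
  filter_upwards [Metric.ball_mem_nhds c hR] with w hw
  have hcauchy : ∀ n, (2 * Real.pi * Complex.I : ℂ)⁻¹ • ∮ ζ in C(c, R), (ζ - w)⁻¹ • F n ζ = F n w :=
    fun n => DiffContOnCl.two_pi_i_inv_smul_circleIntegral_sub_inv_smul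
      (DifferentiableOn.diffContOnCl_ball (U := Metric.closedBall c R) (fun ζ hζ => (hF n ζ (hRU hζ)).differentiableAt.differentiableWithinAt) le_rfl) hw
  have h1 : Tendsto (fun n => (2 * Real.pi * Complex.I : ℂ)⁻¹ • ∮ ζ in C(c, R), (ζ - w)⁻¹ • F n ζ)
      atTop (𝓝 ((2 * Real.pi * Complex.I : ℂ)⁻¹ • ∮ ζ in C(c, R), (ζ - w)⁻¹ • f ζ)) := by
    refine Tendsto.const_smul ?_ _
    simp only [circleIntegral]
    have hne : ∀ θ, circleMap c R θ - w ≠ 0 := fun θ h => by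
      have := circleMap_mem_sphere c R.2 θ
      have h' : dist w c = R := sub_eq_zero.1 h ▸ Metric.mem_sphere.1 this
      exact (Metric.mem_ball.1 hw).ne h'
    have hk : Continuous fun θ => (circleMap c R θ - w)⁻¹ :=
      ((continuous_circleMap c R).sub continuous_const).inv₀ hne
    have hd : Continuous fun θ => deriv (circleMap c R) θ := by
      simp only [deriv_circleMap]
      exact (continuous_circleMap 0 R).mul continuous_const
    refine intervalIntegral.tendsto_integral_filter_of_dominated_convergence
      (fun θ => ‖deriv (circleMap c R) θ‖ * (‖(circleMap c R θ - w)⁻¹‖ * C)) ?_ ?_ ?_ ?_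
    · exact Eventually.of_forall fun n => (hd.smul (hk.smul (hcont n))).aestronglyMeasurable
    · refine Eventually.of_forall fun n => ae_of_all _ fun θ _ => ?_
      rw [norm_smul, norm_smul]
      gcongr
      exact hFC n _ (Metric.sphere_subset_closedBall (circleMap_mem_sphere c R.2 θ))
    · exact (hd.norm.mul (hk.norm.mul continuous_const)).intervalIntegrable _ _
    · exact ae_of_all _ fun θ _ => ((hlim θ).const_smul _).const_smul _
  simp only [hcauchy] at h1
  exact tendsto_nhds_unique h1 (hf w (hRU (Metric.ball_subset_closedBall hw)))

/-- A family which is unique for each `z` depends analytically on `z`. -/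
theorem analyticAt_wtFamily {R : ℂ → TreeEdge K → ℂ} (hL : ∀ e, 0 < L e)
    (hR : ∀ w : ℂ, 0 < w.im → ∀ r', IsWTFamily L w r' → r' = R w) (hz : 0 < z.im)
    (e : TreeEdge K) : AnalyticAt ℂ (fun w => R w e) z := by
  refine analyticAt_of_tendsto_of_bound (U := {w : ℂ | 0 < w.im})
    (F := fun n w => wtApprox L w (n + 1) e)
    (b := fun w => 2 * Real.sqrt ‖w‖ / (1 - Real.exp (-2 * L e * (csqrt w).im)))
    (isOpen_lt continuous_const Complex.continuous_im)
    (fun n w hw => analyticAt_wtApprox hL hw _ e)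
    (fun w hw => (tendsto_add_atTop_iff_nat 1).2 (tendsto_wtApprox hL hw (hR w hw) e)) ?_
    (fun n w hw => norm_wtApprox_le hL hw n e) hz
  have hcs : ContinuousOn csqrt {w : ℂ | 0 < w.im} := fun w hw =>
    (analyticAt_csqrt hw).continuousAt.continuousWithinAt
  refine ContinuousOn.div (by fun_prop) ?_ fun w hw => ?_
  · exact continuousOn_const.sub
      ((continuousOn_const.mul (Complex.continuous_im.comp_continuousOn hcs)).rexp)
  · exact (one_sub_exp_pos (hL e) (csqrt_im_pos hw)).ne'

end Families

/-! ### Square integrable solutions from families -/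

section Sol

variable {K : ℕ} {L : TreeEdge K → ℝ} {z : ℂ} {r : TreeEdge K → ℂ} {u : TreePoint K}

theorem TreePoint.start_self (u : TreePoint K) : u.start u.edge = u.pos := if_pos rfl

theorem TreePoint.start_of_ne {f : TreeEdge K} (h : f ≠ u.edge) : u.start f = 0 := if_neg h

@[simp] theorem TreePoint.start_root (f : TreeEdge K) : (TreePoint.root K).start f = 0 := by
  unfold TreePoint.start TreePoint.root
  split_ifs <;> rfl

theorem TreePoint.start_nonneg (h0 : 0 ≤ u.pos) (f : TreeEdge K) : 0 ≤ u.start f := by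
  unfold TreePoint.start
  split_ifs
  exacts [h0, le_rfl]

theorem TreePoint.start_lt (hL : ∀ e, 0 < L e) (h1 : u.pos < L u.edge) (f : TreeEdge K) :
    u.start f < L f := by
  unfold TreePoint.start
  split_ifs with h
  exacts [h ▸ h1, hL f]

theorem TreePoint.Below.mem_Icc (h0 : 0 ≤ u.pos) {f : TreeEdge K} {x : ℝ} (h : u.Below L f x) :
    x ∈ Icc 0 (L f) :=
  ⟨(TreePoint.start_nonneg h0 f).trans h.2.1, h.2.2⟩

theorem TreePoint.below_root {f : TreeEdge K} {x : ℝ} (h : x ∈ Icc 0 (L f)) :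
    (TreePoint.root K).Below L f x :=
  ⟨List.nil_suffix, by simpa using h⟩

/-- The value at the near end of an edge of the solution with logarithmic derivatives `r`,
normalized at the root. -/
noncomputable def wtAmp (L : TreeEdge K → ℝ) (z : ℂ) (r : TreeEdge K → ℂ) : TreeEdge K → ℂ
  | [] => 1
  | _ :: e => wtAmp L z r e * edgeVal (csqrt z) 1 (r e) (L e)

/-- The solution of `-ψ'' = z ψ` on the tree whose logarithmic derivatives at the near ends of the
edges are `r`, normalized at the root. -/
noncomputable def wtSol (L : TreeEdge K → ℝ) (z : ℂ) (r : TreeEdge K → ℂ) : TreeFun K where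
  val e x := wtAmp L z r e * edgeVal (csqrt z) 1 (r e) x
  der e x := wtAmp L z r e * edgeDer (csqrt z) 1 (r e) x
  der2 e x := wtAmp L z r e * (-z * edgeVal (csqrt z) 1 (r e) x)

theorem wtAmp_ne_zero (hz : 0 < z.im) (hr : IsWTFamily L z r) (e : TreeEdge K) :
    wtAmp L z r e ≠ 0 := by
  induction e with
  | nil => exact one_ne_zero
  | cons i e ih => exact mul_ne_zero ih ((hr e).2.edgeVal_ne_zero hz)

theorem IsWTFamily.sum_im_nonneg (hr : IsWTFamily L z r) (e : TreeEdge K) :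
    0 ≤ (∑ i : Fin K, r (i :: e)).im :=
  (sum_mem_wtCone _ fun _ _ => (hr _).1).1

theorem IsWTFamily.edgeVal_ne_zero (hz : 0 < z.im) (hr : IsWTFamily L z r) {e : TreeEdge K} {x : ℝ}
    (hx : x ≤ L e) : edgeVal (csqrt z) 1 (r e) x ≠ 0 := by
  rcases hx.lt_or_eq with hx | rfl
  · intro h
    have := (hr e).2.im_pos_of_lt hz (hr.sum_im_nonneg e) hx
    simp [h] at this
  · exact (hr e).2.edgeVal_ne_zero hz

theorem wtSol_val_ne_zero (hz : 0 < z.im) (hr : IsWTFamily L z r) {e : TreeEdge K} {x : ℝ}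
    (hx : x ≤ L e) : (wtSol L z r).val e x ≠ 0 :=
  mul_ne_zero (wtAmp_ne_zero hz hr e) (hr.edgeVal_ne_zero hz hx)

/-- The mass of the solution on an edge is the loss of the flux `Im (conj ψ * ψ')` along it. -/
theorem wtSol_mass (hL : ∀ e, 0 < L e) (hz : 0 < z.im) (hr : IsWTFamily L z r) (e : TreeEdge K) :
    z.im * (∫ x in (0 : ℝ)..(L e), ‖(wtSol L z r).val e x‖ ^ 2) =
      (r e).im * ‖wtAmp L z r e‖ ^ 2 -
        ∑ i : Fin K, (r (i :: e)).im * ‖wtAmp L z r (i :: e)‖ ^ 2 := by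
  have h := (hr e).2.im_eq hz (hL e).le
  rw [edgeVal_zero, edgeDer_zero, map_one, one_mul] at h
  simp only [wtSol, wtAmp, norm_mul, mul_pow, intervalIntegral.integral_const_mul]
  rw [← Finset.sum_mul, ← Complex.im_sum, h]
  ring

theorem summable_wtSol (hL : ∀ e, 0 < L e) (hz : 0 < z.im) (hr : IsWTFamily L z r) :
    Summable fun e => ∫ x in (0 : ℝ)..(L e), ‖(wtSol L z r).val e x‖ ^ 2 := by
  have hnn : ∀ e, 0 ≤ ∫ x in (0 : ℝ)..(L e), ‖(wtSol L z r).val e x‖ ^ 2 := fun e =>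
    integral_norm_sq_nonneg (hL e).le
  refine summable_of_sum_le (c := (r []).im / z.im) hnn fun t => ?_
  obtain ⟨n, hn⟩ := (tendsto_treeBall.eventually_ge_atTop t).exists
  refine (Finset.sum_le_sum_of_subset_of_nonneg hn fun e _ _ => hnn e).trans ?_
  rw [le_div_iff₀ hz, mul_comm, Finset.mul_sum,
    sum_treeBall_telescope (G := fun e => (r e).im * ‖wtAmp L z r e‖ ^ 2) (wtSol_mass hL hz hr)]
  have : 0 ≤ ∑ e ∈ treeLevel K n, (r e).im * ‖wtAmp L z r e‖ ^ 2 :=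
    Finset.sum_nonneg fun e _ => mul_nonneg (hr e).1.1 (by positivity)
  simp only [wtAmp, norm_one, one_pow, mul_one]
  linarith

theorem isWeylSolution_wtSol (hL : ∀ e, 0 < L e) (hz : 0 < z.im) (hr : IsWTFamily L z r) :
    IsWeylSolution L (TreePoint.root K) z (wtSol L z r) where
  maxDomain :=
    { isH2 := fun f _ => (isH2_edge (csqrt_ne_zero hz) (csqrt_sq z) _ _).const_mul _
      continuous := fun f _ i => by simp [wtSol, wtAmp]
      kirchhoff := fun f _ => by
        have h := (hr f).2
        rw [EdgeRel] at h
        simp only [wtSol, wtAmp, edgeDer_zero, h, ← Finset.mul_sum]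
        ring
      summable_val := by
        simpa [Function.comp_def] using (summable_wtSol hL hz hr).comp_injective
          (Subtype.val_injective (p := fun f : TreeEdge K => (TreePoint.root K).edge <:+ f))
      summable_der2 := by
        have := ((summable_wtSol hL hz hr).mul_left (‖z‖ ^ 2)).comp_injective
          (Subtype.val_injective (p := fun f : TreeEdge K => (TreePoint.root K).edge <:+ f))
        refine this.congr fun f => ?_
        simp only [Function.comp_apply, TreePoint.start_root, ← intervalIntegral.integral_const_mul]
        refine intervalIntegral.integral_congr fun x _ => ?_
        simp only [wtSol, norm_mul, norm_neg]
        ring }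
  equation := fun f _ => ae_of_all _ fun x => by simp only [wtSol]; ring
  normalized := by simp [wtSol, TreePoint.root, wtAmp]

end Sol

/-! ### Operations on the maximal domain -/

theorem IsH2.intervalIntegrable_val_sq {a b : ℝ} {f f' f'' : ℝ → ℂ} (h : IsH2 a b f f' f'')
    (hab : a ≤ b) : IntervalIntegrable (fun x => ‖f x‖ ^ 2) volume a b :=
  ContinuousOn.intervalIntegrable_of_Icc hab ((h.continuousOn_val hab).norm.pow 2)

theorem IsH2.intervalIntegrable_der2_sq {a b : ℝ} {f f' f'' : ℝ → ℂ} (h : IsH2 a b f f' f'')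
    (hab : a ≤ b) : IntervalIntegrable (fun x => ‖f'' x‖ ^ 2) volume a b :=
  (intervalIntegrable_iff_integrableOn_Icc_of_le hab).2
    ((memLp_two_iff_integrable_sq_norm h.memLp.aestronglyMeasurable).1 h.memLp)

theorem summable_integral_norm_sq_sub {ι : Type*} {a b : ι → ℝ} {F G : ι → ℝ → ℂ}
    (hab : ∀ i, a i ≤ b i)
    (hF : ∀ i, IntervalIntegrable (fun x => ‖F i x‖ ^ 2) volume (a i) (b i))
    (hG : ∀ i, IntervalIntegrable (fun x => ‖G i x‖ ^ 2) volume (a i) (b i))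
    (hFG : ∀ i, IntervalIntegrable (fun x => ‖F i x - G i x‖ ^ 2) volume (a i) (b i))
    (sF : Summable fun i => ∫ x in (a i)..(b i), ‖F i x‖ ^ 2)
    (sG : Summable fun i => ∫ x in (a i)..(b i), ‖G i x‖ ^ 2) :
    Summable fun i => ∫ x in (a i)..(b i), ‖F i x - G i x‖ ^ 2 := by
  refine Summable.of_nonneg_of_le (fun i => integral_norm_sq_nonneg (hab i)) (fun i => ?_)
    ((sF.mul_left 2).add (sG.mul_left 2))
  rw [← intervalIntegral.integral_const_mul, ← intervalIntegral.integral_const_mul,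
    ← intervalIntegral.integral_add ((hF i).const_mul 2) ((hG i).const_mul 2)]
  refine intervalIntegral.integral_mono_on (hab i) (hFG i)
    (((hF i).const_mul 2).add ((hG i).const_mul 2)) fun x _ => ?_
  have h1 := norm_sub_le (F i x) (G i x)
  have h2 : ‖F i x - G i x‖ ^ 2 ≤ (‖F i x‖ + ‖G i x‖) ^ 2 :=
    pow_le_pow_left₀ (norm_nonneg _) h1 2
  nlinarith [sq_nonneg (‖F i x‖ - ‖G i x‖)]

section MaxDomain

variable {K : ℕ} {L : TreeEdge K → ℝ} {z : ℂ} {u : TreePoint K} {φ ψ : TreeFun K}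

/-- Pointwise difference of functions on the tree. -/
def TreeFun.sub (φ ψ : TreeFun K) : TreeFun K where
  val e x := φ.val e x - ψ.val e x
  der e x := φ.der e x - ψ.der e x
  der2 e x := φ.der2 e x - ψ.der2 e x

/-- Multiples of a function on the tree. -/
def TreeFun.constMul (c : ℂ) (ψ : TreeFun K) : TreeFun K where
  val e x := c * ψ.val e x
  der e x := c * ψ.der e x
  der2 e x := c * ψ.der2 e x

theorem InMaxDomain.sub (hL : ∀ e, 0 < L e) (h1 : u.pos < L u.edge) (hφ : InMaxDomain L u φ)
    (hψ : InMaxDomain L u ψ) : InMaxDomain L u (φ.sub ψ) := by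
  have hle : ∀ f, u.start f ≤ L f := fun f => (TreePoint.start_lt hL h1 f).le
  have hH : ∀ f, u.edge <:+ f → IsH2 (u.start f) (L f) ((φ.sub ψ).val f) ((φ.sub ψ).der f)
      ((φ.sub ψ).der2 f) := fun f hf => (hφ.isH2 f hf).sub (hψ.isH2 f hf) (hle f)
  refine ⟨hH, fun f hf i => ?_, fun f hf => ?_, ?_, ?_⟩
  · simp only [TreeFun.sub, hφ.continuous f hf i, hψ.continuous f hf i]
  · simp only [TreeFun.sub, hφ.kirchhoff f hf, hψ.kirchhoff f hf, Finset.sum_sub_distrib]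
  · exact summable_integral_norm_sq_sub (fun f => hle f.1)
      (fun f => (hφ.isH2 f.1 f.2).intervalIntegrable_val_sq (hle f.1))
      (fun f => (hψ.isH2 f.1 f.2).intervalIntegrable_val_sq (hle f.1))
      (fun f => (hH f.1 f.2).intervalIntegrable_val_sq (hle f.1)) hφ.summable_val hψ.summable_val
  · exact summable_integral_norm_sq_sub (fun f => hle f.1)
      (fun f => (hφ.isH2 f.1 f.2).intervalIntegrable_der2_sq (hle f.1))
      (fun f => (hψ.isH2 f.1 f.2).intervalIntegrable_der2_sq (hle f.1))
      (fun f => (hH f.1 f.2).intervalIntegrable_der2_sq (hle f.1)) hφ.summable_der2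
      hψ.summable_der2

theorem InMaxDomain.constMul (hψ : InMaxDomain L u ψ) (c : ℂ) :
    InMaxDomain L u (ψ.constMul c) where
  isH2 f hf := (hψ.isH2 f hf).const_mul c
  continuous f hf i := by simp only [TreeFun.constMul, hψ.continuous f hf i]
  kirchhoff f hf := by simp only [TreeFun.constMul, hψ.kirchhoff f hf, Finset.mul_sum]
  summable_val := by
    simpa only [TreeFun.constMul, norm_mul, mul_pow, intervalIntegral.integral_const_mul] using
      hψ.summable_val.mul_left (‖c‖ ^ 2)
  summable_der2 := by
    simpa only [TreeFun.constMul, norm_mul, mul_pow, intervalIntegral.integral_const_mul] using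
      hψ.summable_der2.mul_left (‖c‖ ^ 2)

/-- Restriction to a forward subtree. -/
theorem InMaxDomain.restrict (hL : ∀ e, 0 < L e) (h0 : 0 ≤ u.pos) (h1 : u.pos < L u.edge)
    (hψ : InMaxDomain L (TreePoint.root K) ψ) : InMaxDomain L u ψ := by
  have hle : ∀ f, u.start f ≤ L f := fun f => (TreePoint.start_lt hL h1 f).le
  have hH : ∀ f, IsH2 0 (L f) (ψ.val f) (ψ.der f) (ψ.der2 f) := fun f => by
    simpa using hψ.isH2 f List.nil_suffix
  have key : ∀ F : TreeEdge K → ℝ → ℂ,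
      (∀ f, IntervalIntegrable (fun x => ‖F f x‖ ^ 2) volume 0 (L f)) →
      (Summable fun f : {f : TreeEdge K // (TreePoint.root K).edge <:+ f} =>
        ∫ x in ((TreePoint.root K).start f.1)..(L f.1), ‖F f.1 x‖ ^ 2) →
      Summable fun f : {f : TreeEdge K // u.edge <:+ f} =>
        ∫ x in (u.start f.1)..(L f.1), ‖F f.1 x‖ ^ 2 := by
    intro F hF hS
    let ι : {f : TreeEdge K // u.edge <:+ f} → {f : TreeEdge K // (TreePoint.root K).edge <:+ f} :=
      fun f => ⟨f.1, List.nil_suffix⟩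
    have hι : Function.Injective ι := fun _ _ h => Subtype.ext (Subtype.ext_iff.1 h :)
    refine Summable.of_nonneg_of_le (fun f => integral_norm_sq_nonneg (hle f.1)) (fun f => ?_)
      (hS.comp_injective hι)
    simp only [Function.comp_apply, TreePoint.start_root]
    exact intervalIntegral.integral_mono_interval (TreePoint.start_nonneg h0 _) (hle _) le_rfl
      (ae_of_all _ fun x => by positivity) (hF f.1)
  exact ⟨fun f _ => (hH f).mono (TreePoint.start_nonneg h0 f) (hle f),
    fun f _ i => hψ.continuous f List.nil_suffix i, fun f _ => hψ.kirchhoff f List.nil_suffix,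
    key ψ.val (fun f => (hH f).intervalIntegrable_val_sq (hL f).le) hψ.summable_val,
    key ψ.der2 (fun f => (hH f).intervalIntegrable_der2_sq (hL f).le) hψ.summable_der2⟩

/-- The solution on the whole tree, rescaled, is a Weyl solution on every forward subtree. -/
theorem IsWeylSolution.restrict (hL : ∀ e, 0 < L e) (h0 : 0 ≤ u.pos) (h1 : u.pos < L u.edge)
    (hψ : IsWeylSolution L (TreePoint.root K) z ψ) (hne : ψ.val u.edge u.pos ≠ 0) :
    IsWeylSolution L u z (ψ.constMul (ψ.val u.edge u.pos)⁻¹) where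
  maxDomain := (hψ.maxDomain.restrict hL h0 h1).constMul _
  equation f _ := by
    have h := hψ.equation f List.nil_suffix
    have hsub : Icc (u.start f) (L f) ⊆ Icc ((TreePoint.root K).start f) (L f) := by
      rw [TreePoint.start_root]
      exact Icc_subset_Icc_left (TreePoint.start_nonneg h0 f)
    filter_upwards [ae_mono (Measure.restrict_mono hsub le_rfl) h] with x hx
    simp only [TreeFun.constMul]
    linear_combination (ψ.val u.edge u.pos)⁻¹ * hx
  normalized := inv_mul_cancel₀ hne

end MaxDomain

/-! ### Cubic interpolation -/

/-- The cubic polynomial on `[0, l]` which vanishes to second order at `0` and has value `A` and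
slope `B` at `l`. -/
noncomputable def cubicVal (A B : ℂ) (l x : ℝ) : ℂ :=
  (3 * A - B * l) / l ^ 2 * x ^ 2 + (B * l - 2 * A) / l ^ 3 * x ^ 3

/-- The derivative of `cubicVal A B l`. -/
noncomputable def cubicDer (A B : ℂ) (l x : ℝ) : ℂ :=
  2 * ((3 * A - B * l) / l ^ 2) * x + 3 * ((B * l - 2 * A) / l ^ 3) * x ^ 2

/-- The second derivative of `cubicVal A B l`. -/
noncomputable def cubicDer2 (A B : ℂ) (l x : ℝ) : ℂ :=
  2 * ((3 * A - B * l) / l ^ 2) + 6 * ((B * l - 2 * A) / l ^ 3) * x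

section Cubic

variable {A B : ℂ} {l : ℝ}

@[simp] theorem cubicVal_zero : cubicVal A B l 0 = 0 := by simp [cubicVal]

@[simp] theorem cubicDer_zero : cubicDer A B l 0 = 0 := by simp [cubicDer]

theorem cubicVal_end (hl : 0 < l) : cubicVal A B l l = A := by
  have : (l : ℂ) ≠ 0 := by exact_mod_cast hl.ne'
  rw [cubicVal]; field_simp; ring

theorem cubicDer_end (hl : 0 < l) : cubicDer A B l l = B := by
  have : (l : ℂ) ≠ 0 := by exact_mod_cast hl.ne'
  rw [cubicDer]; field_simp; ring

theorem continuous_cubicDer2 : Continuous (cubicDer2 A B l) := by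
  unfold cubicDer2; fun_prop

theorem continuous_cubicVal : Continuous (cubicVal A B l) := by
  unfold cubicVal; fun_prop

theorem isH2_cubic (a b : ℝ) : IsH2 a b (cubicVal A B l) (cubicDer A B l) (cubicDer2 A B l) := by
  refine IsH2.of_hasDerivAt (fun x => ?_) (fun x => ?_) continuous_cubicDer2
  · have h := (((hasDerivAt_id (x : ℂ)).pow 2).const_mul ((3 * A - B * l) / l ^ 2)).add
      (((hasDerivAt_id (x : ℂ)).pow 3).const_mul ((B * l - 2 * A) / l ^ 3))
    refine h.comp_ofReal.congr_deriv ?_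
    simp only [cubicDer, id]; push_cast; ring
  · have h := ((hasDerivAt_id (x : ℂ)).const_mul (2 * ((3 * A - B * l) / l ^ 2))).add
      (((hasDerivAt_id (x : ℂ)).pow 2).const_mul (3 * ((B * l - 2 * A) / l ^ 3)))
    refine h.comp_ofReal.congr_deriv ?_
    simp only [cubicDer2, id]; push_cast; ring

end Cubic

/-! ### Uniqueness from the symmetry of the Laplacian -/

section Extend

variable {K : ℕ} {L : TreeEdge K → ℝ} {z : ℂ} {u : TreePoint K} {η : TreeFun K} {α : ℝ}

open Classical in
/-- Modification of a function on a forward subtree to a function on the whole tree: the values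
on the edge of the cut `u` are replaced by a cubic polynomial that vanishes to second order at the
near end of the edge, and the values off the subtree by zero. -/
noncomputable def TreeFun.extend (L : TreeEdge K → ℝ) (u : TreePoint K) (η : TreeFun K) :
    TreeFun K where
  val f x := if f = u.edge then cubicVal (η.val f (L f)) (η.der f (L f)) (L f) x else
    if u.edge <:+ f then η.val f x else 0
  der f x := if f = u.edge then cubicDer (η.val f (L f)) (η.der f (L f)) (L f) x else
    if u.edge <:+ f then η.der f x else 0
  der2 f x := if f = u.edge then cubicDer2 (η.val f (L f)) (η.der f (L f)) (L f) x else
    if u.edge <:+ f then η.der2 f x else 0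

open Classical in
theorem TreeFun.extend_end (hL : ∀ e, 0 < L e) (f : TreeEdge K) :
    (η.extend L u).val f (L f) = (if u.edge <:+ f then η.val f (L f) else 0) ∧
    (η.extend L u).der f (L f) = (if u.edge <:+ f then η.der f (L f) else 0) := by
  by_cases h : f = u.edge
  · subst h
    simp [TreeFun.extend, cubicVal_end (hL _), cubicDer_end (hL _)]
  · simp [TreeFun.extend, h]

open Classical in
theorem TreeFun.extend_child (f : TreeEdge K) (i : Fin K) :
    (η.extend L u).val (i :: f) 0 = (if u.edge <:+ f then η.val (i :: f) 0 else 0) ∧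
    (η.extend L u).der (i :: f) 0 = (if u.edge <:+ f then η.der (i :: f) 0 else 0) := by
  by_cases h : i :: f = u.edge
  · have hn : ¬ u.edge <:+ f := fun hs => by
      have := hs.length_le
      rw [← h, List.length_cons] at this
      omega
    simp [TreeFun.extend, h, hn]
  · have : u.edge <:+ i :: f ↔ u.edge <:+ f := by
      rw [List.suffix_cons_iff]
      exact or_iff_right fun h' => h h'.symm
    simp [TreeFun.extend, h, this]

theorem summable_extend {G H : TreeEdge K → ℝ}
    (hG : Summable fun f : {f : TreeEdge K // u.edge <:+ f} => G f.1)
    (h : ∀ f, f ≠ u.edge → u.edge <:+ f → H f = G f) (h0 : ∀ f, ¬ u.edge <:+ f → H f = 0) :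
    Summable H := by
  have h1 : Summable ({f : TreeEdge K | u.edge <:+ f}.indicator G) :=
    summable_subtype_iff_indicator.1 hG
  refine h1.congr_cofinite ?_
  refine (Set.Finite.subset (Set.finite_singleton u.edge) fun f hf => ?_)
  by_contra hne
  refine hf ?_
  by_cases hs : u.edge <:+ f
  · simp [hs, h f hne hs]
  · simp [hs, h0 f hs]

theorem InMaxDomain.extend (hL : ∀ e, 0 < L e) (hη : InMaxDomain L u η) (α : ℝ) :
    InLaplacianDomain L α (η.extend L u) := by
  have hroot : (η.extend L u).val [] 0 = 0 ∧ (η.extend L u).der [] 0 = 0 := by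
    by_cases h : [] = u.edge
    · simp [TreeFun.extend, h]
    · have : ¬ u.edge <:+ [] := fun hs => h (List.suffix_nil.1 hs).symm
      simp [TreeFun.extend, h, this]
  refine ⟨⟨fun f _ => ?_, fun f _ i => ?_, fun f _ => ?_, ?_, ?_⟩, by simp [hroot]⟩
  · rw [TreePoint.start_root]
    by_cases h : f = u.edge
    · simpa [TreeFun.extend, h] using isH2_cubic _ _
    · by_cases hs : u.edge <:+ f
      · simpa [TreeFun.extend, h, hs, TreePoint.start_of_ne h] using hη.isH2 f hs
      · simpa [TreeFun.extend, h, hs] using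
          IsH2.of_hasDerivAt (f := fun _ => 0) (f' := fun _ => 0) (f'' := fun _ => 0)
            (fun x => hasDerivAt_const x (0 : ℂ)) (fun x => hasDerivAt_const x (0 : ℂ))
            continuous_const
  · rw [(TreeFun.extend_child f i).1, (TreeFun.extend_end hL f).1]
    split_ifs with h
    · exact hη.continuous f h i
    · rfl
  · rw [(TreeFun.extend_end hL f).2, Finset.sum_congr rfl fun i _ => (TreeFun.extend_child f i).2]
    split_ifs with h
    · exact hη.kirchhoff f h
    · simp
  · refine Summable.comp_injective (f := fun f => ∫ x in (0 : ℝ)..(L f),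
      ‖(η.extend L u).val f x‖ ^ 2) ?_ Subtype.val_injective |>.congr fun f => by
        simp only [Function.comp_apply, TreePoint.start_root]
    refine summable_extend
      (G := fun f => ∫ x in (u.start f)..(L f), ‖η.val f x‖ ^ 2) hη.summable_val (fun f h hs => ?_) fun f hs => ?_
    · simp [TreeFun.extend, h, hs, TreePoint.start_of_ne h]
    · have h : f ≠ u.edge := fun h => hs (h ▸ List.suffix_rfl)
      simp [TreeFun.extend, h, hs]
  · refine Summable.comp_injective (f := fun f => ∫ x in (0 : ℝ)..(L f),
      ‖(η.extend L u).der2 f x‖ ^ 2) ?_ Subtype.val_injective |>.congr fun f => by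
        simp only [Function.comp_apply, TreePoint.start_root]
    refine summable_extend
      (G := fun f => ∫ x in (u.start f)..(L f), ‖η.der2 f x‖ ^ 2) hη.summable_der2 (fun f h hs => ?_) fun f hs => ?_
    · simp [TreeFun.extend, h, hs, TreePoint.start_of_ne h]
    · have h : f ≠ u.edge := fun h => hs (h ▸ List.suffix_rfl)
      simp [TreeFun.extend, h, hs]

open Classical in
/-- The mass of `η` on the edges of the forward subtree beyond the edge of the cut. -/
noncomputable def massBeyond (L : TreeEdge K → ℝ) (u : TreePoint K) (η : TreeFun K)
    (f : TreeEdge K) : ℝ :=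
  if f ≠ u.edge ∧ u.edge <:+ f then ∫ x in (0 : ℝ)..(L f), ‖η.val f x‖ ^ 2 else 0

theorem massBeyond_nonneg (hL : ∀ e, 0 < L e) (f : TreeEdge K) : 0 ≤ massBeyond L u η f := by
  unfold massBeyond
  split_ifs
  exacts [integral_norm_sq_nonneg (hL f).le, le_rfl]

theorem InMaxDomain.summable_massBeyond (hη : InMaxDomain L u η) :
    Summable (massBeyond L u η) := by
  refine summable_extend
      (G := fun f => ∫ x in (u.start f)..(L f), ‖η.val f x‖ ^ 2) hη.summable_val (fun f h hs => ?_) fun f hs => ?_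
  · simp [massBeyond, h, hs, TreePoint.start_of_ne h]
  · simp [massBeyond, hs]

/-- If the Laplacian is symmetric, no flux escapes to infinity: the flux of a square integrable
solution through the far end of the edge of the cut is proportional to the mass beyond. -/
theorem InMaxDomain.flux_eq (hL : ∀ e, 0 < L e) (hsymm : LaplacianIsSymmetric L α)
    (hη : InMaxDomain L u η)
    (heq : ∀ f, u.edge <:+ f →
      ∀ᵐ x ∂(volume.restrict (Icc (u.start f) (L f))), -η.der2 f x = z * η.val f x) :
    ((starRingEnd ℂ) (η.val u.edge (L u.edge)) * η.der u.edge (L u.edge)).im =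
      z.im * ∑' f, massBeyond L u η f := by
  classical
  have hdom := hη.extend hL α
  have hs := hsymm _ _ hdom hdom
  set A := η.val u.edge (L u.edge) with hA
  set B := η.der u.edge (L u.edge) with hB
  set p := cubicVal A B (L u.edge)
  set p2 := cubicDer2 A B (L u.edge)
  set a : ℂ := ∫ x in (0 : ℝ)..(L u.edge), (starRingEnd ℂ) (p2 x) * p x with ha
  set b : ℂ := ∫ x in (0 : ℝ)..(L u.edge), (starRingEnd ℂ) (p x) * p2 x with hb
  have hae : ∀ f, f ≠ u.edge → u.edge <:+ f →
      ∀ᵐ x, x ∈ Set.uIoc 0 (L f) → -η.der2 f x = z * η.val f x := by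
    intro f h hs
    have := (ae_restrict_iff' measurableSet_Icc).1 (heq f hs)
    rw [TreePoint.start_of_ne h] at this
    filter_upwards [this] with x hx hxm
    rw [uIoc_of_le (hL f).le] at hxm
    exact hx ⟨hxm.1.le, hxm.2⟩
  have e1 : ∀ f, ∫ x in (0 : ℝ)..(L f), (starRingEnd ℂ) (-(η.extend L u).der2 f x) *
      (η.extend L u).val f x =
        (starRingEnd ℂ) z * (massBeyond L u η f : ℂ) + if f = u.edge then -a else 0 := by
    intro f
    by_cases h : f = u.edge
    · subst h
      simp [TreeFun.extend, massBeyond, ha, p, p2, A, B]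
    · by_cases hs : u.edge <:+ f
      · simp only [TreeFun.extend, massBeyond, h, hs, if_true, if_false, add_zero, ne_eq,
          not_false_eq_true, and_self]
        rw [← intervalIntegral.integral_ofReal, ← intervalIntegral.integral_const_mul]
        refine intervalIntegral.integral_congr_ae ?_
        filter_upwards [hae f h hs] with x hx hxm
        rw [hx hxm, map_mul, mul_assoc, Complex.conj_mul']
        push_cast; rfl
      · simp [TreeFun.extend, massBeyond, h, hs]
  have e2 : ∀ f, ∫ x in (0 : ℝ)..(L f), (starRingEnd ℂ) ((η.extend L u).val f x) *
      (-(η.extend L u).der2 f x) =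
        z * (massBeyond L u η f : ℂ) + if f = u.edge then -b else 0 := by
    intro f
    by_cases h : f = u.edge
    · subst h
      simp [TreeFun.extend, massBeyond, hb, p, p2, A, B]
    · by_cases hs : u.edge <:+ f
      · simp only [TreeFun.extend, massBeyond, h, hs, if_true, if_false, add_zero, ne_eq,
          not_false_eq_true, and_self]
        rw [← intervalIntegral.integral_ofReal, ← intervalIntegral.integral_const_mul]
        refine intervalIntegral.integral_congr_ae ?_
        filter_upwards [hae f h hs] with x hx hxm
        rw [hx hxm, mul_left_comm, Complex.conj_mul']
        push_cast; rfl
      · simp [TreeFun.extend, massBeyond, h, hs]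
  have hsum : Summable fun f => (massBeyond L u η f : ℂ) :=
    Complex.summable_ofReal.2 hη.summable_massBeyond
  have hite : ∀ c : ℂ, Summable fun f => if f = u.edge then c else 0 := fun c =>
    (hasSum_ite_eq u.edge c).summable
  rw [tsum_congr e1, tsum_congr e2, (hsum.mul_left _).tsum_add (hite _),
    (hsum.mul_left _).tsum_add (hite _), tsum_mul_left, tsum_mul_left, tsum_ite_eq, tsum_ite_eq,
    ← Complex.ofReal_tsum] at hs
  have hg := (isH2_cubic (A := A) (B := B) (l := L u.edge) 0 (L u.edge)).conj.green
    (isH2_cubic (A := A) (B := B) (l := L u.edge) 0 (L u.edge)) (hL _).le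
  simp only [cubicVal_end (hL _), cubicDer_end (hL _), cubicVal_zero, cubicDer_zero, mul_zero,
    sub_zero] at hg
  have hg' : b - a = (starRingEnd ℂ) A * B - (starRingEnd ℂ) B * A := hg
  have h3 := congrArg Complex.im (show (starRingEnd ℂ) A * B - (starRingEnd ℂ) B * A =
    z * (∑' f, massBeyond L u η f : ℝ) - (starRingEnd ℂ) z * (∑' f, massBeyond L u η f : ℝ) by
      rw [← hg']; linear_combination hs)
  simp only [Complex.sub_im, Complex.conj_im, Complex.mul_im, Complex.conj_re, Complex.ofReal_re,
    Complex.ofReal_im] at h3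
  simp only [Complex.mul_im, Complex.conj_re, Complex.conj_im]
  linarith

theorem IsH2.eq_zero_of_integral {a b : ℝ} {f f' f'' : ℝ → ℂ} (h : IsH2 a b f f' f'') (hab : a < b)
    (h0 : ∫ x in a..b, ‖f x‖ ^ 2 = 0) {x : ℝ} (hx : x ∈ Icc a b) : f x = 0 ∧ f' x = 0 := by
  have hf : ∀ y ∈ Icc a b, f y = 0 := fun y hy => by
    by_contra hne
    exact (integral_norm_sq_pos hab (h.continuousOn_val hab.le) hy hne).ne' h0
  refine ⟨hf x hx, ?_⟩
  have h1 := h.hasDerivWithinAt hab.le hx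
  have h2 : HasDerivWithinAt f 0 (Icc a b) x :=
    (hasDerivWithinAt_const x _ (0 : ℂ)).congr hf (hf x hx)
  exact (uniqueDiffOn_Icc hab x hx).eq_deriv _ h1 h2

/-- If the Laplacian is symmetric, square integrable solutions vanishing at the cut are zero. -/
theorem InMaxDomain.eq_zero (hL : ∀ e, 0 < L e) (hsymm : LaplacianIsSymmetric L α)
    (hz : 0 < z.im) (h1 : u.pos < L u.edge) (hη : InMaxDomain L u η)
    (heq : ∀ f, u.edge <:+ f →
      ∀ᵐ x ∂(volume.restrict (Icc (u.start f) (L f))), -η.der2 f x = z * η.val f x)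
    (h0 : η.val u.edge u.pos = 0) {f : TreeEdge K} {x : ℝ} (hfx : u.Below L f x) :
    η.val f x = 0 ∧ η.der f x = 0 := by
  have hflux := hη.flux_eq hL hsymm heq
  have hen := (hη.isH2 u.edge List.suffix_rfl).im_energy (TreePoint.start_lt hL h1 _).le
    (heq u.edge List.suffix_rfl)
  have hm0 : 0 ≤ ∑' f, massBeyond L u η f := tsum_nonneg (massBeyond_nonneg hL)
  have hP := integral_norm_sq_nonneg (f := η.val u.edge) (TreePoint.start_lt hL h1 u.edge).le
  rw [TreePoint.start_self] at hen hP
  rw [h0, map_zero, zero_mul, Complex.zero_im, hflux, ← mul_add] at hen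
  have hsum := (mul_eq_zero.1 hen.symm).resolve_left hz.ne'
  have hM : ∑' f, massBeyond L u η f = 0 := by linarith
  have hP0 : ∫ x in u.pos..(L u.edge), ‖η.val u.edge x‖ ^ 2 = 0 := by linarith
  refine (hη.isH2 f hfx.1).eq_zero_of_integral (TreePoint.start_lt hL h1 f) ?_ hfx.2
  by_cases h : f = u.edge
  · subst h
    rwa [TreePoint.start_self]
  · have hz := (hasSum_zero_iff_of_nonneg (massBeyond_nonneg (u := u) (η := η) hL)).1
      (hM ▸ hη.summable_massBeyond.hasSum)
    have := congrFun hz f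
    simpa [massBeyond, h, hfx.1, TreePoint.start_of_ne h] using this

theorem IsWeylSolution.unique {ψ₁ ψ₂ : TreeFun K} (hL : ∀ e, 0 < L e)
    (hsymm : LaplacianIsSymmetric L α) (hz : 0 < z.im) (h1 : u.pos < L u.edge)
    (hψ₁ : IsWeylSolution L u z ψ₁) (hψ₂ : IsWeylSolution L u z ψ₂) {f : TreeEdge K} {x : ℝ}
    (hfx : u.Below L f x) : ψ₁.val f x = ψ₂.val f x ∧ ψ₁.der f x = ψ₂.der f x := by
  have h := (hψ₁.maxDomain.sub hL h1 hψ₂.maxDomain).eq_zero hL hsymm hz h1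
    (fun f hf => by
      filter_upwards [hψ₁.equation f hf, hψ₂.equation f hf] with x e1 e2
      simp only [TreeFun.sub]
      linear_combination e1 - e2)
    (by simp only [TreeFun.sub, hψ₁.normalized, hψ₂.normalized, sub_self]) hfx
  exact ⟨sub_eq_zero.1 h.1, sub_eq_zero.1 h.2⟩

end Extend

/-! ### Symmetry of the Laplacian for edge lengths bounded below -/

theorem sq_integral_norm_le {F : ℝ → ℂ} {a b : ℝ} (hab : a < b)
    (hF : IntervalIntegrable F volume a b)
    (hF2 : IntervalIntegrable (fun x => ‖F x‖ ^ 2) volume a b) :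
    (∫ x in a..b, ‖F x‖) ^ 2 ≤ (b - a) * ∫ x in a..b, ‖F x‖ ^ 2 := by
  set I := ∫ x in a..b, ‖F x‖ with hI
  have hba : 0 < b - a := sub_pos.2 hab
  -- the variance of `‖F‖` about its mean `m` is nonnegative
  set m := I / (b - a) with hm
  have h0 : 0 ≤ ∫ x in a..b, (‖F x‖ - m) ^ 2 :=
    intervalIntegral.integral_nonneg hab.le fun _ _ => sq_nonneg _
  have h1 : ∫ x in a..b, (‖F x‖ - m) ^ 2 =
      (∫ x in a..b, ‖F x‖ ^ 2) - 2 * m * I + (b - a) * m ^ 2 := by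
    have : ∀ x, (‖F x‖ - m) ^ 2 = ‖F x‖ ^ 2 - 2 * m * ‖F x‖ + m ^ 2 := fun x => by ring
    simp only [this]
    rw [intervalIntegral.integral_add (hF2.sub (hF.norm.const_mul _)) intervalIntegrable_const,
      intervalIntegral.integral_sub hF2 (hF.norm.const_mul _),
      intervalIntegral.integral_const_mul, intervalIntegral.integral_const, smul_eq_mul]
  rw [h1] at h0
  have h2 : (b - a) * m = I := by rw [hm]; field_simp
  nlinarith [mul_nonneg hba.le h0]

section Sobolev

variable {a b : ℝ} {f f' f'' g g' g'' : ℝ → ℂ}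

/-- The squared Sobolev norm of a function on an interval. -/
noncomputable def sobolevSq (a b : ℝ) (f f'' : ℝ → ℂ) : ℝ :=
  (∫ x in a..b, ‖f x‖ ^ 2) + ∫ x in a..b, ‖f'' x‖ ^ 2

/-- Sobolev bound for boundary values, with a constant depending only on a lower bound for the
length of the interval: integrate against a cubic weight supported near the end point. -/
theorem exists_boundary_bound {l : ℝ} (hl : 0 < l) (A B : ℂ) :
    ∃ C : ℝ, 0 ≤ C ∧ ∀ {a b : ℝ} {f f' f'' : ℝ → ℂ}, l ≤ b - a → IsH2 a b f f' f'' →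
      ‖A * f' b - B * f b‖ ^ 2 ≤ C * sobolevSq a b f f'' := by
  obtain ⟨M1, hM1⟩ := (isCompact_Icc (a := (0 : ℝ)) (b := l)).exists_bound_of_continuousOn
    (continuous_cubicVal (A := A) (B := B) (l := l)).continuousOn
  obtain ⟨M2, hM2⟩ := (isCompact_Icc (a := (0 : ℝ)) (b := l)).exists_bound_of_continuousOn
    (continuous_cubicDer2 (A := A) (B := B) (l := l)).continuousOn
  set M := max M1 M2
  refine ⟨2 * M ^ 2 * l, by positivity, fun {a b f f' f''} hab hf => ?_⟩
  have hM0 : 0 ≤ M := (norm_nonneg _).trans ((hM1 0 ⟨le_rfl, hl.le⟩).trans (le_max_left _ _))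
  set c := b - l with hc
  have hac : a ≤ c := by linarith
  have hcb : c < b := by linarith
  have hfc := hf.mono hac hcb.le
  set p : ℝ → ℂ := fun x => cubicVal A B l (x - c) with hp
  set p2 : ℝ → ℂ := fun x => cubicDer2 A B l (x - c) with hp2
  have hpH : IsH2 c b p (fun x => cubicDer A B l (x - c)) p2 := by
    have h1 : ∀ x, HasDerivWithinAt (cubicVal A B l) (cubicDer A B l x) (Icc (x - 1) (x + 1)) x :=
      fun x => (isH2_cubic _ _).hasDerivWithinAt (by linarith) ⟨by linarith, by linarith⟩
    have h2 : ∀ x, HasDerivWithinAt (cubicDer A B l) (cubicDer2 A B l x) (Icc (x - 1) (x + 1)) x :=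
      fun x => hasDerivWithinAt_of_eq_primitive (by linarith) continuous_cubicDer2.continuousOn
        (isH2_cubic (A := A) (B := B) (l := l) _ _).der_eq ⟨by linarith, by linarith⟩
    refine IsH2.of_hasDerivAt (fun x => ?_) (fun x => ?_)
      (continuous_cubicDer2.comp (continuous_id.sub continuous_const))
    · exact ((h1 (x - c)).hasDerivAt
        (Icc_mem_nhds (by linarith) (by linarith))).comp_sub_const x c
    · exact ((h2 (x - c)).hasDerivAt
        (Icc_mem_nhds (by linarith) (by linarith))).comp_sub_const x c
  have hg := hpH.green hfc hcb.le
  have hbc : b - c = l := by rw [hc]; ring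
  simp only [hp, sub_self, cubicVal_zero, cubicDer_zero, zero_mul, sub_zero, hbc, cubicVal_end hl,
    cubicDer_end hl] at hg
  have hi2 := hfc.intervalIntegrable_der2 hcb.le
  have hi0 : IntervalIntegrable f volume c b :=
    ContinuousOn.intervalIntegrable_of_Icc hcb.le (hfc.continuousOn_val hcb.le)
  have b1 : ‖∫ x in c..b, cubicVal A B l (x - c) * f'' x‖ ≤ M * ∫ x in c..b, ‖f'' x‖ := by
    rw [← intervalIntegral.integral_const_mul]
    refine intervalIntegral.norm_integral_le_of_norm_le hcb.le (ae_of_all _ fun x hx => ?_)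
      (hi2.norm.const_mul _)
    rw [norm_mul]
    exact mul_le_mul_of_nonneg_right ((hM1 _ ⟨by linarith [hx.1], by linarith [hx.2]⟩).trans
      (le_max_left _ _)) (norm_nonneg _)
  have b2 : ‖∫ x in c..b, p2 x * f x‖ ≤ M * ∫ x in c..b, ‖f x‖ := by
    rw [← intervalIntegral.integral_const_mul]
    refine intervalIntegral.norm_integral_le_of_norm_le hcb.le (ae_of_all _ fun x hx => ?_)
      (hi0.norm.const_mul _)
    rw [norm_mul]
    exact mul_le_mul_of_nonneg_right ((hM2 _ ⟨by linarith [hx.1], by linarith [hx.2]⟩).trans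
      (le_max_right _ _)) (norm_nonneg _)
  have s1 := sq_integral_norm_le hcb hi2 (hfc.intervalIntegrable_der2_sq hcb.le)
  have s2 := sq_integral_norm_le hcb hi0 (hfc.intervalIntegrable_val_sq hcb.le)
  rw [hbc] at s1 s2
  have m1 : ∫ x in c..b, ‖f'' x‖ ^ 2 ≤ ∫ x in a..b, ‖f'' x‖ ^ 2 :=
    intervalIntegral.integral_mono_interval hac hcb.le le_rfl
      (ae_of_all _ fun x => by positivity)
      (hf.intervalIntegrable_der2_sq (hac.trans hcb.le))
  have m2 : ∫ x in c..b, ‖f x‖ ^ 2 ≤ ∫ x in a..b, ‖f x‖ ^ 2 :=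
    intervalIntegral.integral_mono_interval hac hcb.le le_rfl
      (ae_of_all _ fun x => by positivity)
      (hf.intervalIntegrable_val_sq (hac.trans hcb.le))
  have hn : ‖A * f' b - B * f b‖ ≤ M * (∫ x in c..b, ‖f'' x‖) + M * ∫ x in c..b, ‖f x‖ := by
    rw [← hg]
    exact (norm_sub_le _ _).trans (add_le_add b1 b2)
  set I1 := ∫ x in c..b, ‖f'' x‖
  set I2 := ∫ x in c..b, ‖f x‖
  calc ‖A * f' b - B * f b‖ ^ 2 ≤ (M * I1 + M * I2) ^ 2 :=
        pow_le_pow_left₀ (norm_nonneg _) hn 2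
    _ ≤ 2 * M ^ 2 * (I1 ^ 2 + I2 ^ 2) := by
        nlinarith [mul_nonneg (sq_nonneg M) (sq_nonneg (I1 - I2))]
    _ ≤ 2 * M ^ 2 * (l * (∫ x in a..b, ‖f'' x‖ ^ 2) + l * ∫ x in a..b, ‖f x‖ ^ 2) := by
        gcongr
        · exact s1.trans (mul_le_mul_of_nonneg_left m1 hl.le)
        · exact s2.trans (mul_le_mul_of_nonneg_left m2 hl.le)
    _ = 2 * M ^ 2 * l * sobolevSq a b f f'' := by rw [sobolevSq]; ring

theorem exists_wronskian_bound {l : ℝ} (hl : 0 < l) :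
    ∃ C : ℝ, ∀ {a b : ℝ} {f f' f'' g g' g'' : ℝ → ℂ}, l ≤ b - a → IsH2 a b f f' f'' →
      IsH2 a b g g' g'' → ‖(starRingEnd ℂ) (f b) * g' b - (starRingEnd ℂ) (f' b) * g b‖ ≤
        C * (sobolevSq a b f f'' + sobolevSq a b g g'') := by
  obtain ⟨C1, -, h1⟩ := exists_boundary_bound hl 1 0
  obtain ⟨C2, -, h2⟩ := exists_boundary_bound hl 0 1
  refine ⟨C1 + C2, fun {a b f f' f'' g g' g''} hab hf hg => ?_⟩
  have e1 := h1 hab hf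
  have e2 := h2 hab hf
  have e3 := h1 hab hg
  have e4 := h2 hab hg
  simp only [one_mul, zero_mul, sub_zero, zero_sub, norm_neg] at e1 e2 e3 e4
  have := norm_sub_le ((starRingEnd ℂ) (f b) * g' b) ((starRingEnd ℂ) (f' b) * g b)
  simp only [norm_mul, RCLike.norm_conj] at this
  nlinarith [sq_nonneg (‖f b‖ - ‖g' b‖), sq_nonneg (‖f' b‖ - ‖g b‖), sq_nonneg ‖f b‖,
    sq_nonneg ‖f' b‖, sq_nonneg ‖g b‖, sq_nonneg ‖g' b‖]

theorem norm_integral_mul_le (hab : a ≤ b)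
    (hf : IntervalIntegrable (fun x => ‖f x‖ ^ 2) volume a b)
    (hg : IntervalIntegrable (fun x => ‖g x‖ ^ 2) volume a b) :
    ‖∫ x in a..b, f x * g x‖ ≤ (∫ x in a..b, ‖f x‖ ^ 2) + ∫ x in a..b, ‖g x‖ ^ 2 := by
  rw [← intervalIntegral.integral_add hf hg]
  refine intervalIntegral.norm_integral_le_of_norm_le hab (ae_of_all _ fun x _ => ?_) (hf.add hg)
  rw [norm_mul]
  nlinarith [sq_nonneg (‖f x‖ - ‖g x‖), sq_nonneg ‖f x‖, sq_nonneg ‖g x‖]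

end Sobolev

section Symmetric

variable {K : ℕ} {L : TreeEdge K → ℝ} {φ ψ : TreeFun K} {α : ℝ}

theorem InLaplacianDomain.isH2 (h : InLaplacianDomain L α ψ) (e : TreeEdge K) :
    IsH2 0 (L e) (ψ.val e) (ψ.der e) (ψ.der2 e) := by
  simpa using h.maxDomain.isH2 e List.nil_suffix

theorem InLaplacianDomain.summable_sobolevSq (h : InLaplacianDomain L α ψ) :
    Summable fun e => sobolevSq 0 (L e) (ψ.val e) (ψ.der2 e) := by
  have key : ∀ F : TreeEdge K → ℝ, (Summable fun f : {f : TreeEdge K //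
      (TreePoint.root K).edge <:+ f} => F f.1) → Summable F := fun F hF =>
    hF.comp_injective
      (i := fun e : TreeEdge K => (⟨e, List.nil_suffix⟩ :
        {f : TreeEdge K // (TreePoint.root K).edge <:+ f}))
      fun a b hab => (Subtype.ext_iff.1 hab :)
  have h1 := h.maxDomain.summable_val
  have h2 := h.maxDomain.summable_der2
  simp only [TreePoint.start_root] at h1 h2
  exact (key (fun e => ∫ x in (0 : ℝ)..(L e), ‖ψ.val e x‖ ^ 2) h1).add
    (key (fun e => ∫ x in (0 : ℝ)..(L e), ‖ψ.der2 e x‖ ^ 2) h2)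

/-- For edge lengths bounded below, the Wronskian of two functions in the domain, summed over a
generation, is dominated by the terms of a convergent series, so that there is no boundary term at
infinity. -/
theorem laplacianIsSymmetric_of_le {l : ℝ} (hl : 0 < l) (hL : ∀ e, l ≤ L e) (α : ℝ) :
    LaplacianIsSymmetric L α := by
  intro φ ψ hφ hψ
  have hL0 : ∀ e, 0 ≤ L e := fun e => hl.le.trans (hL e)
  set N : TreeEdge K → ℝ := fun e => sobolevSq 0 (L e) (φ.val e) (φ.der2 e) +
    sobolevSq 0 (L e) (ψ.val e) (ψ.der2 e) with hN
  have hNs : Summable N := hφ.summable_sobolevSq.add hψ.summable_sobolevSq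
  set F₁ : TreeEdge K → ℂ := fun e =>
    ∫ x in (0 : ℝ)..(L e), (starRingEnd ℂ) (-φ.der2 e x) * ψ.val e x with hF₁
  set F₂ : TreeEdge K → ℂ := fun e =>
    ∫ x in (0 : ℝ)..(L e), (starRingEnd ℂ) (φ.val e x) * (-ψ.der2 e x) with hF₂
  have pos : ∀ (e : TreeEdge K) (f : ℝ → ℂ), 0 ≤ ∫ x in (0 : ℝ)..(L e), ‖f x‖ ^ 2 := fun e f =>
    integral_norm_sq_nonneg (hL0 e)
  have s1 : Summable F₁ := by
    refine Summable.of_norm_bounded hNs fun e => ?_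
    have := norm_integral_mul_le (f := fun x => (starRingEnd ℂ) (-φ.der2 e x)) (g := ψ.val e)
      (hL0 e) (by simpa using (hφ.isH2 e).intervalIntegrable_der2_sq (hL0 e))
      ((hψ.isH2 e).intervalIntegrable_val_sq (hL0 e))
    simp only [RCLike.norm_conj, norm_neg] at this
    simp only [hN, sobolevSq, hF₁]
    linarith [pos e (φ.val e), pos e (ψ.der2 e)]
  have s2 : Summable F₂ := by
    refine Summable.of_norm_bounded hNs fun e => ?_
    have := norm_integral_mul_le (f := fun x => (starRingEnd ℂ) (φ.val e x))
      (g := fun x => -ψ.der2 e x)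
      (hL0 e) (by simpa using (hφ.isH2 e).intervalIntegrable_val_sq (hL0 e))
      (by simpa using (hψ.isH2 e).intervalIntegrable_der2_sq (hL0 e))
    simp only [RCLike.norm_conj, norm_neg] at this
    simp only [hN, sobolevSq, hF₂]
    linarith [pos e (φ.der2 e), pos e (ψ.val e)]
  set G : TreeEdge K → ℂ := fun e =>
    (starRingEnd ℂ) (φ.val e 0) * ψ.der e 0 - (starRingEnd ℂ) (φ.der e 0) * ψ.val e 0 with hG
  have hend : ∀ e, (starRingEnd ℂ) (φ.val e (L e)) * ψ.der e (L e) -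
      (starRingEnd ℂ) (φ.der e (L e)) * ψ.val e (L e) = ∑ i : Fin K, G (i :: e) := by
    intro e
    rw [hψ.maxDomain.kirchhoff e List.nil_suffix, hφ.maxDomain.kirchhoff e List.nil_suffix, map_sum,
      Finset.mul_sum, Finset.sum_mul, ← Finset.sum_sub_distrib]
    refine Finset.sum_congr rfl fun i _ => ?_
    simp only [hG, hψ.maxDomain.continuous e List.nil_suffix i,
      hφ.maxDomain.continuous e List.nil_suffix i]
  have hbal : ∀ e, F₂ e - F₁ e = G e - ∑ i : Fin K, G (i :: e) := by
    intro e
    have hg := (hφ.isH2 e).conj.green (hψ.isH2 e) (hL0 e)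
    rw [hend e] at hg
    simp only [hF₁, hF₂, map_neg, neg_mul, mul_neg, intervalIntegral.integral_neg]
    linear_combination -hg
  have hroot : G [] = 0 := by
    have h1 := congrArg (starRingEnd ℂ) hφ.root_condition
    have h2 := hψ.root_condition
    simp only [map_sub, map_mul, Complex.conj_ofReal, map_zero] at h1
    have hcs : (Real.cos α : ℂ) ^ 2 + (Real.sin α : ℂ) ^ 2 = 1 := by
      exact_mod_cast Real.cos_sq_add_sin_sq α
    simp only [hG]
    linear_combination (-((starRingEnd ℂ) (φ.val [] 0) * ψ.der [] 0 -
      (starRingEnd ℂ) (φ.der [] 0) * ψ.val [] 0)) * hcs +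
      ((Real.cos α : ℂ) * ψ.der [] 0 + (Real.sin α : ℂ) * ψ.val [] 0) * h1 -
      ((Real.cos α : ℂ) * (starRingEnd ℂ) (φ.der [] 0) +
        (Real.sin α : ℂ) * (starRingEnd ℂ) (φ.val [] 0)) * h2
  obtain ⟨C, hC⟩ := exists_wronskian_bound hl
  have hlevel : Tendsto (fun n => ∑ e ∈ treeLevel K (n + 1), G e) atTop (𝓝 0) := by
    have h0 := (tendsto_sum_treeLevel_zero hNs).const_mul C
    rw [mul_zero] at h0
    refine squeeze_zero_norm (fun n => ?_) h0
    rw [sum_treeLevel_succ, Finset.mul_sum]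
    refine norm_sum_le_of_le _ fun e _ => ?_
    rw [← hend e]
    exact hC (by simpa using hL e) (hφ.isH2 e) (hψ.isH2 e)
  have hball : Tendsto (fun n => ∑ e ∈ treeBall K n, (F₂ e - F₁ e)) atTop (𝓝 0) := by
    have := ((tendsto_add_atTop_iff_nat
      (f := fun n => ∑ e ∈ treeLevel K n, G e) 1).1 hlevel).const_sub (G [])
    rw [hroot, sub_zero] at this
    refine this.congr fun n => ?_
    rw [sum_treeBall_telescope hbal, hroot]
  have hlim := (s2.sub s1).hasSum.comp tendsto_treeBall
  have h0 := tendsto_nhds_unique hlim hball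
  rw [s2.tsum_sub s1] at h0
  exact (sub_eq_zero.1 h0).symm

end Symmetric

/-! ### The Weyl–Titchmarsh function -/

section WT

variable {K : ℕ} {L : TreeEdge K → ℝ} {z : ℂ} {r : TreeEdge K → ℂ} {α : ℝ} {u : TreePoint K}

/-- If the Laplacian is symmetric, there is only one family of Weyl–Titchmarsh values. -/
theorem IsWTFamily.unique (hL : ∀ e, 0 < L e) (hsymm : LaplacianIsSymmetric L α) (hz : 0 < z.im)
    (hr : IsWTFamily L z r) (r' : TreeEdge K → ℂ) (hr' : IsWTFamily L z r') : r' = r := by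
  funext e
  have h := (isWeylSolution_wtSol hL hz hr').unique hL hsymm hz (hL [])
    (isWeylSolution_wtSol hL hz hr) (TreePoint.below_root ⟨le_rfl, (hL e).le⟩)
  simp only [wtSol, edgeVal_zero, edgeDer_zero, mul_one] at h
  have h2 := h.2
  rw [h.1] at h2
  exact mul_left_cancel₀ (wtAmp_ne_zero hz hr e) h2

theorem wtFun_eq (hL : ∀ e, 0 < L e) (hsymm : LaplacianIsSymmetric L α) (hz : 0 < z.im)
    (hr : IsWTFamily L z r) {e : TreeEdge K} {l : ℝ} (hl : l ∈ Icc 0 (L e)) :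
    wtFun L e l z = edgeDer (csqrt z) 1 (r e) l / edgeVal (csqrt z) 1 (r e) l := by
  have hW := isWeylSolution_wtSol hL hz hr
  have hex : ∃ ψ : TreeFun K, IsWeylSolution L (TreePoint.root K) z ψ := ⟨_, hW⟩
  have h := hex.choose_spec.unique hL hsymm hz (hL []) hW (TreePoint.below_root hl)
  rw [wtFun, dif_pos hex, h.1, h.2]
  exact mul_div_mul_left _ _ (wtAmp_ne_zero hz hr e)

theorem wtFun_zero (hL : ∀ e, 0 < L e) (hsymm : LaplacianIsSymmetric L α) (hz : 0 < z.im)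
    (hr : IsWTFamily L z r) (e : TreeEdge K) : wtFun L e 0 z = r e := by
  rw [wtFun_eq hL hsymm hz hr ⟨le_rfl, (hL e).le⟩, edgeVal_zero, edgeDer_zero, div_one]

theorem wtFun_end (hL : ∀ e, 0 < L e) (hsymm : LaplacianIsSymmetric L α) (hz : 0 < z.im)
    (hr : IsWTFamily L z r) (e : TreeEdge K) : wtFun L e (L e) z = ∑ i : Fin K, r (i :: e) := by
  rw [wtFun_eq hL hsymm hz hr ⟨(hL e).le, le_rfl⟩, (hr e).2,
    mul_div_cancel_right₀ _ ((hr e).2.edgeVal_ne_zero hz)]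

theorem IsWTFamily.norm_le (hL : ∀ e, 0 < L e) (hz : 0 < z.im) (hr : IsWTFamily L z r)
    (e : TreeEdge K) :
    ‖r e‖ ≤ 2 * Real.sqrt ‖z‖ / (1 - Real.exp (-2 * L e * (csqrt z).im)) :=
  (hr e).2.norm_le hz (hL e) (sum_mem_wtCone _ fun _ _ => (hr _).1)

theorem IsWTFamily.im_pos (hL : ∀ e, 0 < L e) (hz : 0 < z.im) (hr : IsWTFamily L z r)
    (e : TreeEdge K) : 0 < (r e).im := by
  simpa using (hr e).2.im_pos_of_lt hz (hr.sum_im_nonneg e) (hL e)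

/-- Every Weyl solution on a forward subtree is a multiple of the solution on the whole tree. -/
theorem weylSolution_ne_zero_and_wtFun_eq (hL : ∀ e, 0 < L e) (hsymm : LaplacianIsSymmetric L α)
    (hz : 0 < z.im) (h0 : 0 ≤ u.pos) (h1 : u.pos < L u.edge) :
    (∃ ψ : TreeFun K, IsWeylSolution L u z ψ) ∧
      ∀ ψ : TreeFun K, IsWeylSolution L u z ψ → ∀ e l, u.Below L e l →
        ψ.val e l ≠ 0 ∧ wtFun L e l z = ψ.der e l / ψ.val e l := by
  obtain ⟨r, hr⟩ := exists_wtFamily hL hz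
  have hu := wtSol_val_ne_zero hz hr h1.le
  have hR := (isWeylSolution_wtSol hL hz hr).restrict hL h0 h1 hu
  refine ⟨⟨_, hR⟩, fun ψ hψ e l hel => ?_⟩
  have h := hψ.unique hL hsymm hz h1 hR hel
  have hl := hel.mem_Icc h0
  rw [h.1, h.2]
  refine ⟨mul_ne_zero (inv_ne_zero hu) (wtSol_val_ne_zero hz hr hl.2), ?_⟩
  rw [wtFun_eq hL hsymm hz hr hl]
  simp only [TreeFun.constMul]
  rw [mul_div_mul_left _ _ (inv_ne_zero hu)]
  exact (mul_div_mul_left _ _ (wtAmp_ne_zero hz hr e)).symm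

theorem analyticOnNhd_wtFun (hL : ∀ e, 0 < L e) (hsymm : LaplacianIsSymmetric L α)
    (e : TreeEdge K) {l : ℝ} (hl : l ∈ Icc 0 (L e)) :
    AnalyticOnNhd ℂ (wtFun L e l) {z : ℂ | 0 < z.im} := by
  have hex : ∀ w : ℂ, 0 < w.im → ∃ r, IsWTFamily L w r := fun w hw => exists_wtFamily hL hw
  choose! R hR using hex
  intro z hz
  have hs := analyticAt_csqrt hz
  have hr : AnalyticAt ℂ (fun w => R w e) z :=
    analyticAt_wtFamily hL (fun w hw => (hR w hw).unique hL hsymm hw) hz e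
  have harg : AnalyticAt ℂ (fun w => csqrt w * (l : ℂ)) z := hs.mul analyticAt_const
  have hcos : AnalyticAt ℂ (fun w => Complex.cos (csqrt w * (l : ℂ))) z :=
    (Complex.differentiable_cos.analyticAt _).fun_comp harg
  have hsin : AnalyticAt ℂ (fun w => Complex.sin (csqrt w * (l : ℂ))) z :=
    (Complex.differentiable_sin.analyticAt _).fun_comp harg
  have h : AnalyticAt ℂ
      (fun w => edgeDer (csqrt w) 1 (R w e) l / edgeVal (csqrt w) 1 (R w e) l) z :=
    ((hr.mul hcos).sub (analyticAt_const.mul (hs.mul hsin))).div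
      ((analyticAt_const.mul hcos).add (hr.mul (hsin.div hs (csqrt_ne_zero hz))))
      ((hR z hz).edgeVal_ne_zero hz hl.2)
  refine h.congr ?_
  filter_upwards [(isOpen_lt continuous_const Complex.continuous_im).mem_nhds hz] with w hw
  exact (wtFun_eq hL hsymm hw (hR w hw) hl).symm

theorem wtFun_im_pos (hK : 1 ≤ K) (hL : ∀ e, 0 < L e) (hsymm : LaplacianIsSymmetric L α)
    (hz : 0 < z.im) (e : TreeEdge K) {l : ℝ} (hl : l ∈ Icc 0 (L e)) :
    0 < (wtFun L e l z).im := by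
  obtain ⟨r, hr⟩ := exists_wtFamily hL hz
  rcases hl.2.lt_or_eq with hlt | rfl
  · rw [wtFun_eq hL hsymm hz hr hl]
    have h := (hr e).2.im_pos_of_lt hz (hr.sum_im_nonneg e) hlt
    have hne := hr.edgeVal_ne_zero hz hl.2
    set V := edgeVal (csqrt z) 1 (r e) l
    set D := edgeDer (csqrt z) 1 (r e) l
    have : D / V = ((starRingEnd ℂ) V * D) * ((‖V‖ ^ 2)⁻¹ : ℝ) := by
      push_cast
      rw [← Complex.conj_mul']
      have : (starRingEnd ℂ) V ≠ 0 := by simpa using hne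
      field_simp
    rw [this, Complex.im_mul_ofReal]
    exact mul_pos h (by positivity)
  · rw [wtFun_end hL hsymm hz hr, Complex.im_sum]
    exact Finset.sum_pos (fun i _ => hr.im_pos hL hz _) ⟨⟨0, hK⟩, Finset.mem_univ _⟩

theorem wtFun_bounds (hK : 1 ≤ K) (hL : ∀ e, 0 < L e) (hsymm : LaplacianIsSymmetric L α)
    (hz : 0 < z.im) (e : TreeEdge K) :
    ‖wtFun L e 0 z‖ ≤ 2 * Real.sqrt ‖z‖ / (1 - Real.exp (-2 * L e * (csqrt z).im)) ∧
    ‖wtFun L e (L e) z‖ ≤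
      ∑ i : Fin K, 2 * Real.sqrt ‖z‖ / (1 - Real.exp (-2 * L (i :: e) * (csqrt z).im)) ∧
    ‖wtFun L e (L e) z‖ ≤ 2 * K * Real.sqrt ‖z‖ *
      (1 - Real.exp (-2 * (⨅ i : Fin K, L (i :: e)) * (csqrt z).im))⁻¹ := by
  obtain ⟨r, hr⟩ := exists_wtFamily hL hz
  have hκ := csqrt_im_pos hz
  rw [wtFun_zero hL hsymm hz hr, wtFun_end hL hsymm hz hr]
  have h2 : ‖∑ i : Fin K, r (i :: e)‖ ≤
      ∑ i : Fin K, 2 * Real.sqrt ‖z‖ / (1 - Real.exp (-2 * L (i :: e) * (csqrt z).im)) :=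
    norm_sum_le_of_le _ fun i _ => hr.norm_le hL hz _
  refine ⟨hr.norm_le hL hz e, h2, h2.trans ?_⟩
  have : Nonempty (Fin K) := ⟨⟨0, hK⟩⟩
  obtain ⟨j, hj⟩ := exists_eq_ciInf_of_finite (f := fun i : Fin K => L (i :: e))
  have hmin : ∀ i : Fin K, L (j :: e) ≤ L (i :: e) := fun i =>
    hj ▸ ciInf_le (Set.finite_range _).bddBelow i
  rw [← hj]
  have hterm : ∀ i : Fin K, 2 * Real.sqrt ‖z‖ / (1 - Real.exp (-2 * L (i :: e) * (csqrt z).im)) ≤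
      2 * Real.sqrt ‖z‖ / (1 - Real.exp (-2 * L (j :: e) * (csqrt z).im)) := fun i =>
    div_one_sub_exp_anti (by positivity) hκ (hL _) (hmin i)
  refine (Finset.sum_le_sum fun i _ => hterm i).trans (le_of_eq ?_)
  rw [Finset.sum_const, Finset.card_univ, Fintype.card_fin, nsmul_eq_mul, div_eq_mul_inv]
  ring

theorem wtFun_riccati (hL : ∀ e, 0 < L e) (hsymm : LaplacianIsSymmetric L α) (hz : 0 < z.im)
    (e : TreeEdge K) {l : ℝ} (hl : l ∈ Icc 0 (L e)) :
    HasDerivWithinAt (fun x : ℝ => wtFun L e x z) (-z - wtFun L e l z ^ 2) (Icc 0 (L e)) l := by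
  obtain ⟨r, hr⟩ := exists_wtFamily hL hz
  have hne := hr.edgeVal_ne_zero hz hl.2
  have h := ((hasDerivAt_edgeDer (s := csqrt z) (A := 1) (B := r e) l).div
    (hasDerivAt_edgeVal (csqrt_ne_zero hz) l) hne).hasDerivWithinAt (s := Icc 0 (L e))
  refine (h.congr (fun x hx => wtFun_eq hL hsymm hz hr hx)
    (wtFun_eq hL hsymm hz hr hl)).congr_deriv ?_
  rw [wtFun_eq hL hsymm hz hr hl, csqrt_sq]
  field_simp

theorem wtFun_moebius (hL : ∀ e, 0 < L e) (hsymm : LaplacianIsSymmetric L α) (hz : 0 < z.im)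
    (e : TreeEdge K) {l : ℝ} (hl : l ∈ Icc 0 (L e)) :
    Complex.cos (csqrt z * l) + wtFun L e 0 z * Complex.sin (csqrt z * l) / csqrt z ≠ 0 ∧
    wtFun L e l z =
      (wtFun L e 0 z * Complex.cos (csqrt z * l) - csqrt z * Complex.sin (csqrt z * l)) /
      (Complex.cos (csqrt z * l) + wtFun L e 0 z * Complex.sin (csqrt z * l) / csqrt z) := by
  obtain ⟨r, hr⟩ := exists_wtFamily hL hz
  have hne := hr.edgeVal_ne_zero hz hl.2
  rw [wtFun_eq hL hsymm hz hr hl, wtFun_zero hL hsymm hz hr]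
  simp only [edgeVal, edgeDer, one_mul, ← mul_div_assoc] at hne ⊢
  exact ⟨hne, trivial⟩

/-- Continuity in the edge lengths: limits of families are families for the limiting lengths, and
these are unique. -/
theorem continuousOn_wtFun {l : ℝ} (hl : 0 < l) (hz : 0 < z.im) (e : TreeEdge K) :
    ContinuousOn (fun L : TreeEdge K →ᵤ ℝ => wtFun (UniformFun.toFun L) e 0 z)
      {L | ∀ e, l ≤ UniformFun.toFun L e} := by
  intro L₀ hL₀
  have hex : ∀ L : TreeEdge K →ᵤ ℝ, (∀ e, l ≤ UniformFun.toFun L e) →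
      ∃ r, IsWTFamily (UniformFun.toFun L) z r := fun L hL =>
    exists_wtFamily (fun e => hl.trans_le (hL e)) hz
  choose! R hR using hex
  have hval : ∀ L : TreeEdge K →ᵤ ℝ, (∀ e, l ≤ UniformFun.toFun L e) →
      wtFun (UniformFun.toFun L) e 0 z = R L e := fun L hL =>
    wtFun_zero (fun e => hl.trans_le (hL e)) (laplacianIsSymmetric_of_le hl hL 0) hz (hR L hL) e
  rw [ContinuousWithinAt, tendsto_iff_ultrafilter]
  intro U hU
  have hmem : ∀ᶠ L in (U : Filter (TreeEdge K →ᵤ ℝ)), ∀ e, l ≤ UniformFun.toFun L e :=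
    hU self_mem_nhdsWithin
  have hlim : ∀ e, Tendsto (fun L : TreeEdge K →ᵤ ℝ => UniformFun.toFun L e) U
      (𝓝 (UniformFun.toFun L₀ e)) := fun e =>
    ((UniformFun.uniformContinuous_eval ℝ e).continuous.tendsto L₀).mono_left
      (hU.trans nhdsWithin_le_nhds)
  have hκ := csqrt_im_pos hz
  obtain ⟨r, hr, hlim'⟩ := exists_limit_wtFamily U hlim (z := z) (rs := R)
    (fun _ => 2 * Real.sqrt ‖z‖ / (1 - Real.exp (-2 * l * (csqrt z).im)))
    (fun e => hmem.mono fun L hL =>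
      ((hR L hL).norm_le (fun e => hl.trans_le (hL e)) hz e).trans
        (div_one_sub_exp_anti (by positivity) hκ hl (hL e)))
    (fun e => hmem.mono fun L hL => hR L hL e)
  have hLpos : ∀ e, 0 < UniformFun.toFun L₀ e := fun e => hl.trans_le (hL₀ e)
  have hrR : r = R L₀ :=
    (hR L₀ hL₀).unique hLpos (laplacianIsSymmetric_of_le hl hL₀ 0) hz r hr
  rw [hval L₀ hL₀, ← hrR]
  exact (hlim' e).congr' (hmem.mono fun L hL => (hval L hL).symm)

end WT

end WeylTitchmarsh

theorem theoremA2 (K : ℕ) (hK : 1 ≤ K) :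
    -- trees with arbitrary positive edge lengths whose Laplacian is symmetric on its maximal domain
    (∀ (L : TreeEdge K → ℝ), (∀ e, 0 < L e) →
      ∀ α ∈ Ico (0 : ℝ) Real.pi, LaplacianIsSymmetric L α →
      -- the function `R⁺` is well defined, independently of the choice of the cut `u`
      (∀ z : ℂ, 0 < z.im → ∀ u : TreePoint K, 0 ≤ u.pos → u.pos < L u.edge →
        (∃ ψ : TreeFun K, IsWeylSolution L u z ψ) ∧
        ∀ ψ : TreeFun K, IsWeylSolution L u z ψ → ∀ e l, u.Below L e l →
          ψ.val e l ≠ 0 ∧ wtFun L e l z = ψ.der e l / ψ.val e l) ∧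
      -- it is analytic from the upper half-plane to itself
      (∀ e, ∀ l ∈ Icc 0 (L e),
        AnalyticOnNhd ℂ (wtFun L e l) {z : ℂ | 0 < z.im} ∧
        MapsTo (wtFun L e l) {z : ℂ | 0 < z.im} {z : ℂ | 0 < z.im}) ∧
      -- bounds at the two ends of an edge
      (∀ e, ∀ z : ℂ, 0 < z.im →
        ‖wtFun L e 0 z‖ ≤
          2 * Real.sqrt ‖z‖ / (1 - Real.exp (-2 * L e * (csqrt z).im)) ∧
        ‖wtFun L e (L e) z‖ ≤
          ∑ i : Fin K, 2 * Real.sqrt ‖z‖ /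
            (1 - Real.exp (-2 * L (i :: e) * (csqrt z).im)) ∧
        ‖wtFun L e (L e) z‖ ≤
          2 * K * Real.sqrt ‖z‖ *
            (1 - Real.exp (-2 * (⨅ i : Fin K, L (i :: e)) * (csqrt z).im))⁻¹) ∧
      -- Riccati equation and Moebius evolution along the edges
      (∀ e, ∀ z : ℂ, 0 < z.im → ∀ l ∈ Icc 0 (L e),
        HasDerivWithinAt (fun x : ℝ => wtFun L e x z)
          (-z - wtFun L e l z ^ 2) (Icc 0 (L e)) l ∧
        Complex.cos (csqrt z * l) +
          wtFun L e 0 z * Complex.sin (csqrt z * l) / csqrt z ≠ 0 ∧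
        wtFun L e l z =
          (wtFun L e 0 z * Complex.cos (csqrt z * l) - csqrt z * Complex.sin (csqrt z * l)) /
          (Complex.cos (csqrt z * l) +
            wtFun L e 0 z * Complex.sin (csqrt z * l) / csqrt z))) ∧
    -- edge lengths bounded away from zero
    (∀ Lmin : ℝ, 0 < Lmin →
      -- the above applies
      (∀ L : TreeEdge K → ℝ, (∀ e, Lmin ≤ L e) →
        ∀ α ∈ Ico (0 : ℝ) Real.pi, LaplacianIsSymmetric L α) ∧
      -- continuous dependence on the edge lengths in the uniform topology
      ∀ z : ℂ, 0 < z.im →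
        ContinuousOn (fun L : TreeEdge K →ᵤ ℝ => wtFun (UniformFun.toFun L) [] 0 z)
          {L | ∀ e, Lmin ≤ UniformFun.toFun L e}) := by
  refine ⟨fun L hL α _ hsymm => ⟨fun z hz u h0 h1 => ?_, fun e l hl => ⟨?_, fun z hz => ?_⟩,
    fun e z hz => ?_, fun e z hz l hl => ⟨?_, ?_⟩⟩, fun Lmin hmin => ⟨fun L hL α _ => ?_,
    fun z hz => ?_⟩⟩
  · exact weylSolution_ne_zero_and_wtFun_eq hL hsymm hz h0 h1
  · exact analyticOnNhd_wtFun hL hsymm e hl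
  · exact wtFun_im_pos hK hL hsymm hz e hl
  · exact wtFun_bounds hK hL hsymm hz e
  · exact wtFun_riccati hL hsymm hz e hl
  · exact wtFun_moebius hL hsymm hz e hl
  · exact laplacianIsSymmetric_of_le hmin hL α
  · exact continuousOn_wtFun hmin hz []
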